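/- Let $p\neq q$ be primes, let $K/\mathbb{Q}_p$ be an unramified extension of finite degree $m$ with ring of integers $\mathcal{O}_K$, let $v$ be the valuation on $K$ with $v(p)=1$, and for $x\in K^\times$ call $p^{-v(x)}x\in\mathcal{O}_K^\times$ the unit part of $x$. Let $\zeta\in K$ be a primitive $(p^m-1)$-th root of unity and $d=\gcd(q,p^m-1)$. Let $f\in\mathcal{O}_K[x]$ be a polynomial of degree $q$ that is irreducible over $K$, with roots $\theta_1,\dots,\theta_q$ in an algebraic closure $\overline{K}$, let $\theta$ be one of these roots, and put $\Delta_f=\prod_{i<j}(\theta_i-\theta_j)^2\in K^\times$ (for monic $f$ this is the discriminant of $f$; in general it is the discriminant of $f$ divided by its leading coefficient). Let $u$ be the unit part of $\Delta_f$. 1. $q(q-1)\mid v(\Delta_f)$ if and only if $K(\theta)/K$ is the unique unramified extension of degree $q$ of $K$ inside $\overline{K}$. 2. If $q(q-1)\nmid v(\Delta_f)$, then $q-1$ divides $v(\Delta_f)$ and $\frac{v(\Delta_f)}{q-1}$ is prime to $q$. For every integer $\ell$ that is inverse to $\frac{v(\Delta_f)}{q-1}$ modulo $q$, the integers $r$ for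 which $\zeta^r u^\ell$ is congruent to a $q$-th power modulo $p\mathcal{O}_K$ form exactly one residue class modulo $d$, and for every such $r$ there is an isomorphism $K(\theta)\cong K\big(\sqrt[q]{\zeta^r p}\big)$ of extensions of $K$, for any choice of the $q$-th root in $\overline{K}$. -/

import Mathlib

open Polynomial IntermediateField

namespace PadicExt

noncomputable section

/-- The ring of integers `𝒪_K` of an extension `K` of `ℚ_p`: the integral closure of `ℤ_p` in `K`. -/
abbrev ringOfIntegers (p : ℕ) [Fact p.Prime] (K : Type*) [Field K] [Algebra ℤ_[p] K] :
    Subalgebra ℤ_[p] K :=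
  integralClosure ℤ_[p] K

/-- An algebraic extension `L / F`, where `F` is the fraction field of an integrally closed domain
`A`, is unramified (relative to `A`) if the integral closure of `A` in `L` is unramified
over `A`. -/
def IsUnramifiedExt (A L : Type*) [CommRing A] [Field L] [Algebra A L] : Prop :=
  Algebra.FormallyUnramified A (integralClosure A L)

/-- The `p`-adic valuation on `K`, normalized by `v(p) = 1`, for `K / ℚ_p` finite and unramified:
`v(x)` is the largest integer `n` with `x ∈ p ^ n 𝒪_K` (for `x ≠ 0`; the junk value at `0`
is `0`). -/
def val (p : ℕ) [Fact p.Prime] {K : Type*} [Field K] [Algebra ℤ_[p] K] (x : K) : ℤ :=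
  sSup {n : ℤ | ∃ a : ringOfIntegers p K, x = (p : K) ^ n * (a : K)}

/-- The unit part `p ^ (-v(x)) x` of `x`. -/
def unitPart (p : ℕ) [Fact p.Prime] {K : Type*} [Field K] [Algebra ℤ_[p] K] (x : K) : K :=
  (p : K) ^ (-val p x) * x

/-- `x` lies in `𝒪_K` and is congruent to an `n`-th power modulo `p 𝒪_K`. -/
def IsPowModP (p : ℕ) [Fact p.Prime] {K : Type*} [Field K] [Algebra ℤ_[p] K]
    (n : ℕ) (x : K) : Prop :=
  ∃ c a : ringOfIntegers p K, x = (c : K) ^ n + (p : K) * (a : K)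

/-- The discriminant `∏_{i<j} (θ_i - θ_j) ^ 2` of the roots of `f`, that is, the discriminant of the
monic polynomial proportional to `f`. For monic `f` it is the discriminant of `f`. -/
def rootDiscr {K : Type*} [Field K] (f : K[X]) : K :=
  (C f.leadingCoeff⁻¹ * f).discr

end

end PadicExt

/-!
Write `x ∼ y` if `x / y ≡ 1` modulo the maximal ideal, and let `v` be the spectral norm on
`F = K(θ)`. As `q` is prime to `p`, some translate `x = θ - a` with `a ∈ K` has trace zero; it has
the same discriminant `D` as `θ`, and it is not closer to any element of `K` than to `0`.

If `p` is a uniformizer of `F`, then `x ∼ p ^ n η` for a root of unity `η` of order prime to `p`.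
It is not in `K`, and its conjugates are pairwise incongruent, so `D` has valuation `n q (q - 1)`.

Otherwise `v x ^ q = v p ^ s` with `q ∤ s`. Let `N` be the norm of `x` and `g` its minimal
polynomial. Comparing values of monomials gives `N ∼ ± x ^ q` and `g'(x) ∼ q x ^ (q - 1)`, so
`D ∼ ± q ^ q N ^ (q - 1)` has valuation `s (q - 1)` and, as `N ∼ ± x ^ q`, it is `∼` a `q`-th power
in `F`. If `D = p ^ (s (q - 1)) u` and `s ℓ ≡ 1` modulo `q`, then `u ^ ℓ` is `∼` the product of `p`
and a `q`-th power in `F`. Hence if `ζ ^ r u ^ ℓ` is `∼` a `q`-th power, then so is `ζ ^ r p`, which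
by Hensel's lemma is a `q`-th power in `F`, and its `q`-th root generates `F`.
-/

namespace PadicExt

open scoped NNReal

section LeadingTerms

variable {L : Type*} [Field L] {Γ₀ : Type*} [LinearOrderedCommGroupWithZero Γ₀]

/-- `x` and `y` are nonzero and have the same class in `Lˣ / (1 + 𝔪)`, where `𝔪` is the maximal
ideal of the valuation ring of `v`; in terms of expansions, they have the same leading term. -/
def SameLeadingTerm (v : Valuation L Γ₀) (x y : L) : Prop := v (x - y) < v y

variable {v : Valuation L Γ₀} {x y z w : L}

namespace SameLeadingTerm

lemma val_eq (h : SameLeadingTerm v x y) : v x = v y := v.map_eq_of_sub_lt h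

lemma ne_zero_right (h : SameLeadingTerm v x y) : y ≠ 0 := by
  rintro rfl
  simp [SameLeadingTerm] at h

lemma ne_zero_left (h : SameLeadingTerm v x y) : x ≠ 0 := by
  rw [← v.ne_zero_iff, h.val_eq, v.ne_zero_iff]
  exact h.ne_zero_right

lemma refl (hx : x ≠ 0) : SameLeadingTerm v x x := by
  simpa [SameLeadingTerm, zero_lt_iff] using hx

lemma symm (h : SameLeadingTerm v x y) : SameLeadingTerm v y x := by
  rw [SameLeadingTerm, v.map_sub_swap, h.val_eq]
  exact h

lemma trans (h : SameLeadingTerm v x y) (h' : SameLeadingTerm v y z) :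
    SameLeadingTerm v x z := by
  rw [SameLeadingTerm, ← sub_add_sub_cancel x y z]
  exact v.map_add_lt (h'.val_eq ▸ h) h'

lemma mul (h : SameLeadingTerm v x y) (h' : SameLeadingTerm v z w) :
    SameLeadingTerm v (x * z) (y * w) := by
  have hy : 0 < v y := zero_lt_iff.2 (v.ne_zero_iff.2 h.ne_zero_right)
  have hw : 0 < v w := zero_lt_iff.2 (v.ne_zero_iff.2 h'.ne_zero_right)
  rw [SameLeadingTerm, show x * z - y * w = (x - y) * z + y * (z - w) by ring, map_mul v y]
  refine v.map_add_lt ?_ ?_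
  · rw [map_mul, h'.val_eq]
    exact mul_lt_mul_of_pos_right h hw
  · rw [map_mul]
    exact mul_lt_mul_of_pos_left h' hy

lemma inv (h : SameLeadingTerm v x y) : SameLeadingTerm v x⁻¹ y⁻¹ := by
  have hx := h.ne_zero_left
  have hy := h.ne_zero_right
  have hv : 0 < v (x * y)⁻¹ := zero_lt_iff.2 (v.ne_zero_iff.2 (inv_ne_zero (mul_ne_zero hx hy)))
  rw [SameLeadingTerm, show x⁻¹ - y⁻¹ = (y - x) * (x * y)⁻¹ by field,
    show y⁻¹ = x * (x * y)⁻¹ by field, map_mul, map_mul]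
  exact mul_lt_mul_of_pos_right h.symm hv

lemma div (h : SameLeadingTerm v x y) (h' : SameLeadingTerm v z w) :
    SameLeadingTerm v (x / z) (y / w) := by
  rw [div_eq_mul_inv, div_eq_mul_inv]
  exact h.mul h'.inv

lemma pow (h : SameLeadingTerm v x y) (n : ℕ) : SameLeadingTerm v (x ^ n) (y ^ n) := by
  induction n with
  | zero => simpa using refl (v := v) one_ne_zero
  | succ n ih => simpa only [pow_succ] using ih.mul h

lemma zpow (h : SameLeadingTerm v x y) (n : ℤ) : SameLeadingTerm v (x ^ n) (y ^ n) := by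
  cases n with
  | ofNat n => simpa using h.pow n
  | negSucc n => simpa only [zpow_negSucc] using (h.pow (n + 1)).inv

lemma prod {ι : Type*} {s : Finset ι} {f g : ι → L} (h : ∀ i, SameLeadingTerm v (f i) (g i)) :
    SameLeadingTerm v (∏ i ∈ s, f i) (∏ i ∈ s, g i) :=
  Finset.prod_hom_rel (refl one_ne_zero) fun i _ _ ↦ (h i).mul

/-- With `r = x / y`, the sum `1 + r + ⋯ + r ^ (n - 1)` has the same leading term as `n`, so it
does not vanish. -/
lemma eq_of_pow_eq_pow (h : SameLeadingTerm v x y) {n : ℕ} (hn : v n = 1)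
    (hpow : x ^ n = y ^ n) : x = y := by
  have hy := h.ne_zero_right
  have hr : SameLeadingTerm v (x / y) 1 := by simpa [hy] using h.div (refl hy)
  have hsum : v (∑ i ∈ Finset.range n, ((x / y) ^ i - 1)) < 1 :=
    v.map_sum_lt one_ne_zero fun i _ ↦ by simpa [SameLeadingTerm] using hr.pow i
  have hgeom : (∑ i ∈ Finset.range n, (x / y) ^ i) * (x / y - 1) = 0 := by
    rw [geom_sum_mul, div_pow, hpow, div_self (pow_ne_zero n hy), sub_self]
  refine (div_eq_one_iff_eq hy).1 (sub_eq_zero.1 ((mul_eq_zero.1 hgeom).resolve_left fun h0 ↦ ?_))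
  simp [Finset.sum_sub_distrib, h0, hn] at hsum

lemma exists_pow_eq_of_isAlgClosed [IsAlgClosed L] {n : ℕ} (hn : n ≠ 0)
    (h : SameLeadingTerm v x (y ^ n)) : ∃ z, z ^ n = x ∧ SameLeadingTerm v z y := by
  by_contra! hz
  have hroots : ∀ r ∈ ((X ^ n - C x : L[X]).roots.map fun b ↦ v (y - b)), v y ≤ r := by
    simp only [Multiset.mem_map, forall_exists_index, and_imp]
    rintro _ b hb rfl
    rw [v.map_sub_swap]
    exact not_lt.1 (hz b (by simpa [sub_eq_zero] using (mem_roots'.1 hb).2))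
  have hsplits : (X ^ n - C x : L[X]).Splits := IsAlgClosed.splits _
  have heval := hsplits.eval_eq_prod_roots y
  have hcard := Multiset.pow_card_le_prod hroots
  rw [Multiset.card_map, ← hsplits.natDegree_eq_card_roots, natDegree_X_pow_sub_C] at hcard
  rw [leadingCoeff_X_pow_sub_C (Nat.pos_of_ne_zero hn), one_mul, eval_sub, eval_X_pow,
    eval_C] at heval
  refine hcard.not_gt ?_
  have hlt := h.symm
  rw [SameLeadingTerm, h.val_eq, map_pow, heval, map_multiset_prod, Multiset.map_map] at hlt
  exact hlt

end SameLeadingTerm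

lemma natCast_ne_zero_of_val_eq_one {n : ℕ} (hn : v n = 1) : (n : L) ≠ 0 := by
  rw [← v.ne_zero_iff, hn]
  exact one_ne_zero

lemma ne_zero_of_val_natCast_eq_one {n : ℕ} (hn : v n = 1) : n ≠ 0 :=
  ne_zero_of_map (f := Nat.castRingHom L) (natCast_ne_zero_of_val_eq_one hn)

lemma val_eq_one_of_pow_eq_one {n : ℕ} (hn : n ≠ 0) (hx : x ^ n = 1) : v x = 1 :=
  (pow_eq_one_iff_of_nonneg zero_le hn).1 (by rw [← map_pow, hx, map_one])

lemma val_sub_eq_one_of_pow_eq_one {n : ℕ} (hn : v n = 1) (hx : x ^ n = 1) (hy : y ^ n = 1)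
    (hxy : x ≠ y) : v (x - y) = 1 := by
  have hn0 : n ≠ 0 := ne_zero_of_val_natCast_eq_one hn
  have hvy : v y = 1 := val_eq_one_of_pow_eq_one hn0 hy
  refine (v.map_sub_le (val_eq_one_of_pow_eq_one hn0 hx).le hvy.le).antisymm
    (not_lt.1 fun hlt ↦ hxy ?_)
  exact SameLeadingTerm.eq_of_pow_eq_pow (by rwa [SameLeadingTerm, hvy]) hn (hx.trans hy.symm)

end LeadingTerms

section SpectralValuation

variable (k : Type*) [NontriviallyNormedField k] [CompleteSpace k] [IsUltrametricDist k]
  (L : Type*) [Field L] [Algebra k L] [Algebra.IsAlgebraic k L]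

/-- The extension of the absolute value of `k` to the algebraic extension `L`, as a valuation. -/
noncomputable def spectralVal : Valuation L ℝ≥0 where
  toFun x := ⟨spectralNorm k L x, spectralNorm_nonneg x⟩
  map_zero' := by ext; exact spectralNorm_zero
  map_one' := by ext; exact spectralNorm_one
  map_mul' x y := by ext; exact spectralAlgNorm_mul x y
  map_add_le_max' x y := le_max_iff.2 (le_max_iff.1 (isNonarchimedean_spectralNorm x y))

variable {k L}

lemma coe_spectralVal (x : L) : (spectralVal k L x : ℝ) = spectralNorm k L x := rfl

lemma spectralVal_eq_of_minpoly_eq {E : Type*} [Field E] [Algebra k E] [Algebra.IsAlgebraic k E]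
    {x : L} {y : E} (h : minpoly k x = minpoly k y) : spectralVal k L x = spectralVal k E y := by
  ext
  rw [coe_spectralVal, coe_spectralVal, spectralNorm, spectralNorm, h]

variable (k) in
lemma spectralVal_algebraMap {E : Type*} [Field E] [Algebra k E] [Algebra.IsAlgebraic k E]
    [Algebra E L] [IsScalarTower k E L] (x : E) :
    spectralVal k L (algebraMap E L x) = spectralVal k E x :=
  spectralVal_eq_of_minpoly_eq (minpoly.algebraMap_eq (algebraMap E L).injective x)

lemma sameLeadingTerm_algebraMap_iff {E : Type*} [Field E] [Algebra k E]
    [Algebra.IsAlgebraic k E] [Algebra E L] [IsScalarTower k E L] {x y : E} :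
    SameLeadingTerm (spectralVal k L) (algebraMap E L x) (algebraMap E L y) ↔
      SameLeadingTerm (spectralVal k E) x y := by
  rw [SameLeadingTerm, ← map_sub, spectralVal_algebraMap k, spectralVal_algebraMap k,
    SameLeadingTerm]

lemma spectralVal_algebraMap_base (a : k) : spectralVal k L (algebraMap k L a) = ‖a‖₊ := by
  ext
  exact spectralNorm_extends a

section Tower

variable {K : Type*} [Field K] [Algebra k K] [Algebra K L] [IsScalarTower k K L]

lemma spectralVal_eq_of_isConjRoot {x y : L} (h : IsConjRoot K x y) :
    spectralVal k L x = spectralVal k L y :=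
  spectralVal_eq_of_minpoly_eq (h.of_isScalarTower (Algebra.IsIntegral.isIntegral x))

lemma spectralVal_algHom {Ω : Type*} [Field Ω] [Algebra k Ω] [Algebra.IsAlgebraic k Ω]
    [Algebra K Ω] [IsScalarTower k K Ω] (σ : L →ₐ[K] Ω) (x : L) :
    spectralVal k Ω (σ x) = spectralVal k L x :=
  spectralVal_eq_of_minpoly_eq (minpoly.algHom_eq (σ.restrictScalars k) σ.injective x)

variable [FiniteDimensional K L] [Algebra.IsSeparable K L]

lemma spectralVal_norm (x : L) :
    spectralVal k L (algebraMap K L (Algebra.norm K x)) =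
      spectralVal k L x ^ Module.finrank K L := by
  have : Algebra.IsAlgebraic k (AlgebraicClosure L) := .trans k L _
  have : IsScalarTower k K (AlgebraicClosure L) := .to₁₂₄ k K L _
  rw [← spectralVal_algebraMap k (L := AlgebraicClosure L), ← IsScalarTower.algebraMap_apply,
    Algebra.norm_eq_prod_embeddings, map_prod]
  simp [spectralVal_algHom, AlgHom.card]

lemma SameLeadingTerm.norm {x y : L} (h : SameLeadingTerm (spectralVal k L) x y) :
    SameLeadingTerm (spectralVal k L) (algebraMap K L (Algebra.norm K x))
      (algebraMap K L (Algebra.norm K y)) := by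
  have : Algebra.IsAlgebraic k (AlgebraicClosure L) := .trans k L _
  have : IsScalarTower k K (AlgebraicClosure L) := .to₁₂₄ k K L _
  rw [← sameLeadingTerm_algebraMap_iff (k := k) (L := AlgebraicClosure L),
    ← IsScalarTower.algebraMap_apply, ← IsScalarTower.algebraMap_apply,
    Algebra.norm_eq_prod_embeddings, Algebra.norm_eq_prod_embeddings]
  refine SameLeadingTerm.prod fun σ ↦ ?_
  rw [SameLeadingTerm, ← map_sub, spectralVal_algHom, spectralVal_algHom]
  exact h

lemma spectralVal_trace_le (x : L) :
    spectralVal k L (algebraMap K L (Algebra.trace K L x)) ≤ spectralVal k L x := by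
  have : Algebra.IsAlgebraic k (AlgebraicClosure L) := .trans k L _
  have : IsScalarTower k K (AlgebraicClosure L) := .to₁₂₄ k K L _
  rw [← spectralVal_algebraMap k (L := AlgebraicClosure L), ← IsScalarTower.algebraMap_apply,
    trace_eq_sum_embeddings (AlgebraicClosure L)]
  exact Valuation.map_sum_le _ fun σ _ ↦ (spectralVal_algHom σ x).le

end Tower

/-- Hensel's lemma for `n`-th roots: among the roots of `X ^ n - x` in an algebraic closure, exactly
one has the leading term of `y`, so this root is fixed by conjugation. -/
lemma SameLeadingTerm.exists_pow_eq {x y : L} {n : ℕ} (hn : spectralVal k L n = 1)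
    (h : SameLeadingTerm (spectralVal k L) x (y ^ n)) :
    ∃ z, z ^ n = x ∧ SameLeadingTerm (spectralVal k L) z y := by
  have : Algebra.IsAlgebraic k (AlgebraicClosure L) := .trans k L _
  have hn0 : (n : L) ≠ 0 := natCast_ne_zero_of_val_eq_one hn
  rw [← sameLeadingTerm_algebraMap_iff (k := k) (L := AlgebraicClosure L), map_pow] at h
  obtain ⟨b, hbn, hb⟩ := h.exists_pow_eq_of_isAlgClosed (ne_zero_of_val_natCast_eq_one hn)
  obtain ⟨z, rfl⟩ : b ∈ (⊥ : Subalgebra L (AlgebraicClosure L)) := by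
    have hx : x ≠ 0 := by
      rintro rfl
      exact h.ne_zero_left (map_zero _)
    have hroot : aeval b (X ^ n - C x) = 0 := by simp [hbn]
    by_contra hmem
    obtain ⟨c, hbc, hconj⟩ := (notMem_iff_exists_ne_and_isConjRoot
      ((separable_X_pow_sub_C x hn0 hx).of_dvd (minpoly.dvd L b hroot))
      (IsAlgClosed.splits _)).1 hmem
    have hc : SameLeadingTerm (spectralVal k _) c (algebraMap L _ y) := by
      rwa [SameLeadingTerm, ← spectralVal_eq_of_isConjRoot (hconj.sub_algebraMap y)]
    have hcn : c ^ n = algebraMap L _ x := by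
      simpa [sub_eq_zero] using
        aeval_eq_zero_of_dvd_aeval_eq_zero (minpoly.dvd L b hroot) hconj.aeval_eq_zero
    refine hbc ((hb.trans hc.symm).eq_of_pow_eq_pow ?_ (hbn.trans hcn.symm))
    rw [← map_natCast (algebraMap L _), spectralVal_algebraMap k, hn]
  refine ⟨z, ?_, ?_⟩
  · exact (algebraMap L (AlgebraicClosure L)).injective (by rwa [map_pow])
  · exact sameLeadingTerm_algebraMap_iff.1 hb

end SpectralValuation

section Uniformizer

variable {L : Type*} [Field L]

/-- `π` generates the maximal ideal of the valuation ring of `v`, and this ideal is not zero. -/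
structure IsUniformizer (v : Valuation L ℝ≥0) (π : L) : Prop where
  ne_zero : π ≠ 0
  lt_one : v π < 1
  le_of_lt_one : ∀ x, v x < 1 → v x ≤ v π

namespace IsUniformizer

variable {v : Valuation L ℝ≥0} {π : L} (hπ : IsUniformizer v π)
include hπ

lemma val_pos : 0 < v π := zero_lt_iff.2 (v.ne_zero_iff.2 hπ.ne_zero)

lemma zpow_inj {m n : ℤ} : v π ^ m = v π ^ n ↔ m = n :=
  zpow_right_inj₀ hπ.val_pos hπ.lt_one.ne

lemma exists_val_eq_zpow {x : L} (hx : x ≠ 0) : ∃ n : ℤ, v x = v π ^ n := by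
  have hvx : 0 < v x := zero_lt_iff.2 (v.ne_zero_iff.2 hx)
  obtain ⟨n, hlt, hle⟩ :=
    exists_mem_Ioc_zpow hvx (one_lt_inv_iff₀.2 ⟨hπ.val_pos, hπ.lt_one⟩)
  rw [inv_zpow'] at hlt hle
  refine ⟨-(n + 1), le_antisymm hle (not_lt.1 fun hlt' ↦ hlt.not_ge ?_)⟩
  have hpos := zpow_pos hπ.val_pos (-(n + 1))
  have hquot := hπ.le_of_lt_one (x / π ^ (-(n + 1)))
    (by rwa [map_div₀, map_zpow₀, div_lt_one₀ hpos])
  rw [map_div₀, map_zpow₀, div_le_iff₀ hpos, ← zpow_one_add₀ hπ.val_pos.ne'] at hquot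
  rwa [show -n = 1 + -(n + 1) by ring]

end IsUniformizer

end Uniformizer

section TraceZero

variable {k : Type*} [NontriviallyNormedField k] [CompleteSpace k] [IsUltrametricDist k]
  {K F : Type*} [Field K] [Field F] [Algebra k K] [Algebra k F] [Algebra K F]
  [IsScalarTower k K F] [Algebra.IsAlgebraic k F] [FiniteDimensional K F] [Algebra.IsSeparable K F]

lemma spectralVal_le_sub_of_trace_eq_zero (hn : spectralVal k F (Module.finrank K F) = 1) {x : F}
    (hx : Algebra.trace K F x = 0) (a : K) :
    spectralVal k F x ≤ spectralVal k F (x - algebraMap K F a) := by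
  have ha : spectralVal k F (algebraMap K F a) ≤ spectralVal k F (x - algebraMap K F a) := by
    have h := spectralVal_trace_le (k := k) (K := K) (x - algebraMap K F a)
    rwa [map_sub, hx, Algebra.trace_algebraMap, zero_sub, map_neg, Valuation.map_neg, nsmul_eq_mul,
      map_mul, map_natCast, map_mul, hn, one_mul] at h
  simpa using (spectralVal k F).map_add_le le_rfl ha

variable (K) in
lemma exists_trace_sub_algebraMap_eq_zero (hn : (Module.finrank K F : K) ≠ 0) (t : F) :
    ∃ a : K, Algebra.trace K F (t - algebraMap K F a) = 0 :=
  ⟨(Module.finrank K F : K)⁻¹ * Algebra.trace K F t, by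
    rw [map_sub, Algebra.trace_algebraMap, nsmul_eq_mul, mul_inv_cancel_left₀ hn, sub_self]⟩

end TraceZero

section Discriminant

variable {K F : Type*} [Field K] [Field F] [Algebra K F] {t : F}

lemma adjoin_eq_top_of_notMem_range (hF : (Module.finrank K F).Prime)
    (ht : t ∉ Set.range (algebraMap K F)) : K⟮t⟯ = ⊤ := by
  have := isSimpleOrder_of_finrank_prime K F hF
  refine (eq_bot_or_eq_top K⟮t⟯).resolve_left fun h ↦ ht ?_
  rwa [adjoin_simple_eq_bot_iff, mem_bot] at h

lemma nonempty_algEquiv_adjoin_of_aeval_eq_zero (ht : K⟮t⟯ = ⊤) (hint : IsIntegral K t)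
    {Ω : Type*} [Field Ω] [Algebra K Ω] {α : Ω} (hα : aeval α (minpoly K t) = 0) :
    Nonempty (F ≃ₐ[K] K⟮α⟯) := by
  have hmin : minpoly K t = minpoly K α :=
    minpoly.eq_of_irreducible_of_monic (minpoly.irreducible hint) hα (minpoly.monic hint)
  have hα' : IsIntegral K α := ⟨_, minpoly.monic hint, hα⟩
  have hgen : minpoly K (adjoin.powerBasis hint).gen = minpoly K (adjoin.powerBasis hα').gen := by
    rwa [adjoin.powerBasis_gen, adjoin.powerBasis_gen, minpoly_gen, minpoly_gen]
  exact ⟨((equivOfEq ht).trans topEquiv).symm.trans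
    ((adjoin.powerBasis hint).equivOfMinpoly (adjoin.powerBasis hα') hgen)⟩

lemma aeval_derivative_minpoly_sub_algebraMap (a : K) :
    aeval (t - algebraMap K F a) (minpoly K (t - algebraMap K F a)).derivative =
      aeval t (minpoly K t).derivative := by
  rw [minpoly.sub_algebraMap, derivative_comp]
  simp [aeval_comp]

variable [FiniteDimensional K F] [Algebra.IsSeparable K F] (ht : K⟮t⟯ = ⊤)
include ht

lemma aroots_minpoly {Ω : Type*} [Field Ω] [Algebra K Ω] [IsAlgClosed Ω] :
    (minpoly K t).aroots Ω = (Finset.univ : Finset (F →ₐ[K] Ω)).val.map fun σ ↦ σ t := by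
  have hint : IsIntegral K t := Algebra.IsIntegral.isIntegral t
  have hinj := (Field.primitive_element_iff_algHom_eq_of_eval' K Ω
    (fun _ ↦ IsAlgClosed.splits _) t).1 ht
  refine (Multiset.eq_of_le_of_card_le ?_ ?_).symm
  · refine (Multiset.le_iff_subset
      ((Multiset.nodup_map_iff_of_injective hinj).2 Finset.univ.nodup)).2 fun x hx ↦ ?_
    obtain ⟨σ, -, rfl⟩ := Multiset.mem_map.1 hx
    rw [mem_aroots]
    exact ⟨minpoly.ne_zero hint, by rw [aeval_algHom_apply, minpoly.aeval, map_zero]⟩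
  · rw [Multiset.card_map, Finset.card_val, Finset.card_univ, AlgHom.card K F Ω,
      ← (Field.primitive_element_iff_minpoly_natDegree_eq K t).1 ht]
    exact (card_roots' _).trans_eq (natDegree_map _)

/-- The discriminant is the resultant of the minimal polynomial and its derivative. -/
lemma discr_minpoly_eq_norm : (minpoly K t).discr =
    (-1) ^ (Module.finrank K F * (Module.finrank K F - 1) / 2) *
      Algebra.norm K (aeval t (minpoly K t).derivative) := by
  set g := minpoly K t
  set i := algebraMap K (AlgebraicClosure K)
  have hint : IsIntegral K t := Algebra.IsIntegral.isIntegral t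
  have hdeg : g.natDegree = Module.finrank K F :=
    (Field.primitive_element_iff_minpoly_natDegree_eq K t).1 ht
  have hmonic : g.Monic := minpoly.monic hint
  have hres := resultant_deriv (minpoly.degree_pos hint)
  rw [hmonic.leadingCoeff, mul_one] at hres
  have hnorm : resultant g g.derivative g.natDegree (g.natDegree - 1) =
      Algebra.norm K (aeval t g.derivative) := by
    apply i.injective
    have hprod := resultant_eq_prod_eval (g.map i) (g.derivative.map i) (g.natDegree - 1)
      ((natDegree_map _).trans_le (natDegree_derivative_le _)) (IsAlgClosed.splits _)
    rw [natDegree_map, resultant_map_map, (hmonic.map i).leadingCoeff, one_pow, one_mul,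
      ← aroots_def, aroots_minpoly ht, Multiset.map_map] at hprod
    rw [hprod, Algebra.norm_eq_prod_embeddings]
    exact Finset.prod_congr rfl fun σ _ ↦ by simp [i, aeval_algHom_apply]
  rw [← hdeg, ← hnorm, hres, ← mul_assoc, ← mul_pow, neg_one_mul, neg_neg, one_pow, one_mul]

lemma discr_minpoly_ne_zero : (minpoly K t).discr ≠ 0 := by
  rw [discr_minpoly_eq_norm ht]
  refine mul_ne_zero (pow_ne_zero _ (neg_ne_zero.2 one_ne_zero)) (Algebra.norm_ne_zero_iff.2 ?_)
  exact (Algebra.IsSeparable.isSeparable K t).aeval_derivative_ne_zero (minpoly.aeval K t)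

lemma algHom_aeval_derivative_minpoly {Ω : Type*} [Field Ω] [Algebra K Ω] [IsAlgClosed Ω]
    [DecidableEq (F →ₐ[K] Ω)] (σ : F →ₐ[K] Ω) :
    σ (aeval t (minpoly K t).derivative) = ∏ τ ∈ Finset.univ.erase σ, (σ t - τ t) := by
  classical
  have hinj : Function.Injective fun τ : F →ₐ[K] Ω ↦ τ t :=
    (Field.primitive_element_iff_algHom_eq_of_eval' K Ω (fun _ ↦ IsAlgClosed.splits _) t).1 ht
  have hroots := aroots_minpoly (Ω := Ω) ht
  have hmem : σ t ∈ ((minpoly K t).map (algebraMap K Ω)).roots := by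
    rw [← aroots_def, hroots]
    exact Multiset.mem_map_of_mem (fun τ : F →ₐ[K] Ω ↦ τ t) (Finset.mem_univ σ)
  have hmonic := (minpoly.monic (Algebra.IsIntegral.isIntegral (R := K) t)).map (algebraMap K Ω)
  rw [← aeval_algHom_apply, ← eval_map_algebraMap, ← derivative_map,
    (IsAlgClosed.splits _).eval_root_derivative hmonic hmem, ← aroots_def, hroots,
    ← Multiset.map_erase (fun τ : F →ₐ[K] Ω ↦ τ t) hinj, Multiset.map_map]
  rfl

omit ht in
lemma discr_minpoly_sub_algebraMap (hF : (Module.finrank K F).Prime)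
    (ht : t ∉ Set.range (algebraMap K F)) (a : K) :
    (minpoly K (t - algebraMap K F a)).discr = (minpoly K t).discr := by
  have hta : t - algebraMap K F a ∉ Set.range (algebraMap K F) :=
    fun ⟨b, hb⟩ ↦ ht ⟨b + a, by rw [map_add, hb, sub_add_cancel]⟩
  rw [discr_minpoly_eq_norm (adjoin_eq_top_of_notMem_range hF hta),
    discr_minpoly_eq_norm (adjoin_eq_top_of_notMem_range hF ht),
    aeval_derivative_minpoly_sub_algebraMap]

end Discriminant

section Ramified

lemma exists_ne_val_eq_of_sum_eq_zero {L Γ₀ ι : Type*} [Field L]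
    [LinearOrderedCommGroupWithZero Γ₀] (v : Valuation L Γ₀) {s : Finset ι} {f : ι → L}
    (hsum : ∑ i ∈ s, f i = 0) {k : ι} (hk : k ∈ s) (hfk : f k ≠ 0) :
    ∃ i ∈ s, ∃ j ∈ s, i ≠ j ∧ v (f i) = v (f j) ∧ ∀ l ∈ s, v (f l) ≤ v (f i) := by
  classical
  obtain ⟨i, hi, hmax⟩ := s.exists_max_image (fun i ↦ v (f i)) ⟨k, hk⟩
  have hi0 : v (f i) ≠ 0 := ((zero_lt_iff.2 (v.ne_zero_iff.2 hfk)).trans_le (hmax k hk)).ne'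
  by_contra! h
  refine hi0 ?_
  rw [← v.map_sum_eq_of_lt hi fun j hj ↦ ?_, hsum, map_zero]
  obtain ⟨hj, hji⟩ := Finset.mem_sdiff.1 hj
  refine (hmax j hj).lt_of_ne fun heq ↦ ?_
  obtain ⟨l, hl, hlt⟩ := h i hi j hj (by rintro rfl; simp at hji) heq.symm
  exact (hmax l hl).not_gt hlt

/-- Since `s * ℓ ≡ 1` modulo `q`, the exponent of `π` in `π * (π ^ (s * (q - 1))) ^ ℓ` is divisible
by `q`. -/
lemma exists_mul_sameLeadingTerm_pow {L Γ₀ : Type*} [Field L] [LinearOrderedCommGroupWithZero Γ₀]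
    {v : Valuation L Γ₀} {q : ℕ} {s ℓ : ℤ} (hℓ : s * ℓ ≡ 1 [ZMOD q]) {π D u g d y : L} (hπ : π ≠ 0)
    (hD : D = π ^ (s * (q - 1)) * u) (hDy : SameLeadingTerm v D (y ^ q))
    (hd : SameLeadingTerm v (g * u ^ ℓ) (d ^ q)) :
    ∃ z, SameLeadingTerm v (g * π) (z ^ q) := by
  obtain ⟨j, hj⟩ := hℓ.symm.dvd
  have hu : u ≠ 0 := by
    rintro rfl
    exact hDy.ne_zero_left (by rw [hD, mul_zero])
  have heq : g * π = g * u ^ ℓ / D ^ ℓ * (π ^ (1 + j * (q - 1))) ^ q := by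
    have hexp : s * (q - 1) * ℓ + 1 = (1 + j * (q - 1)) * q := by linear_combination (q - 1) * hj
    rw [← zpow_natCast, ← zpow_mul, ← hexp, hD, mul_zpow, ← zpow_mul, zpow_add_one₀ hπ]
    field_simp
  refine ⟨d / y ^ ℓ * π ^ (1 + j * (q - 1)), ?_⟩
  rw [heq, mul_pow, div_pow, ← zpow_natCast (y ^ ℓ), zpow_comm, zpow_natCast]
  exact (hd.div (hDy.zpow ℓ)).mul (.refl (pow_ne_zero q (zpow_ne_zero _ hπ)))

variable {K F : Type*} [Field K] [Field F] [Algebra K F]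

section Valuation

variable {v : Valuation F ℝ≥0} {π : K} (hπ : IsUniformizer (v.comap (algebraMap K F)) π) {x : F}
  {q : ℕ} {s : ℤ} (hx : v x ^ q = v (algebraMap K F π) ^ s) (hs : IsCoprime s q)
include hπ hx

lemma ne_zero_of_val_pow_eq (hq : q ≠ 0) : x ≠ 0 := by
  rintro rfl
  rw [map_zero, zero_pow hq] at hx
  exact zpow_ne_zero s hπ.val_pos.ne' hx.symm

include hs

lemma modEq_of_val_mul_pow_eq {a b : K} (ha : a ≠ 0) (hb : b ≠ 0) {i j : ℕ}
    (h : v (algebraMap K F a * x ^ i) = v (algebraMap K F b * x ^ j)) : i ≡ j [MOD q] := by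
  rw [← Valuation.comap_apply] at hx
  have hpow (c : K) (hc : c ≠ 0) (l : ℕ) : ∃ n : ℤ,
      v (algebraMap K F c * x ^ l) ^ q = v.comap (algebraMap K F) π ^ (n * q + s * l) := by
    obtain ⟨n, hn⟩ := hπ.exists_val_eq_zpow hc
    refine ⟨n, ?_⟩
    rw [map_mul, ← Valuation.comap_apply, hn, map_pow, mul_pow, pow_right_comm, hx,
      zpow_add₀ hπ.val_pos.ne', zpow_mul, zpow_mul, zpow_natCast, zpow_natCast]
  obtain ⟨n, hn⟩ := hpow a ha i
  obtain ⟨m, hm⟩ := hpow b hb j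
  have heq : n * q + s * i = m * q + s * j := hπ.zpow_inj.1 (by rw [← hn, ← hm, h])
  refine Nat.modEq_iff_dvd.2 (hs.symm.dvd_of_dvd_mul_left ⟨n - m, ?_⟩)
  linear_combination -heq

lemma notMem_range_of_val_pow_eq (hq : 1 < q) : x ∉ Set.range (algebraMap K F) := by
  rintro ⟨a, rfl⟩
  have ha : a ≠ 0 := by
    rintro rfl
    exact ne_zero_of_val_pow_eq hπ hx (by lia) (map_zero _)
  have hmod : 1 ≡ 0 [MOD q] :=
    modEq_of_val_mul_pow_eq hπ hx hs (a := 1) one_ne_zero ha (by simp)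
  exact hq.ne' (Nat.dvd_one.1 ((Nat.modEq_zero_iff_dvd).1 hmod))

variable {g : K[X]} (hg : g.Monic) (hdeg : g.natDegree = q) (hroot : aeval x g = 0)
include hg hdeg hroot

/-- The maximal value in the relation `∑ g_i x ^ i = 0` is attained twice, but only the terms with
indices `0` and `q` can have the same value. -/
lemma val_coeff_mul_pow_lt {i : ℕ} (hi0 : i ≠ 0) (hiq : i < q) :
    v (algebraMap K F (g.coeff i) * x ^ i) < v (x ^ q) := by
  have hx0 := ne_zero_of_val_pow_eq hπ hx hiq.ne_bot
  have htop : algebraMap K F (g.coeff q) * x ^ q = x ^ q := by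
    rw [← hdeg, hg.coeff_natDegree, map_one, one_mul]
  rw [aeval_eq_sum_range, hdeg] at hroot
  simp only [Algebra.smul_def] at hroot
  obtain ⟨j, hj, l, hl, hjl, heq, hmax⟩ := exists_ne_val_eq_of_sum_eq_zero v hroot
    (Finset.self_mem_range_succ q) (by rw [htop]; exact pow_ne_zero q hx0)
  have hle : v (x ^ q) ≤ v (algebraMap K F (g.coeff j) * x ^ j) :=
    htop ▸ hmax q (Finset.self_mem_range_succ q)
  have hpos : 0 < v (x ^ q) := zero_lt_iff.2 (v.ne_zero_iff.2 (pow_ne_zero q hx0))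
  have hcoeff {n : ℕ} (hn : v (x ^ q) ≤ v (algebraMap K F (g.coeff n) * x ^ n)) :
      g.coeff n ≠ 0 := by
    intro h0
    rw [h0, map_zero, zero_mul, map_zero] at hn
    exact hn.not_gt hpos
  have hmod : j ≡ l [MOD q] :=
    modEq_of_val_mul_pow_eq hπ hx hs (hcoeff hle) (hcoeff (heq ▸ hle)) heq
  have hval : v (algebraMap K F (g.coeff j) * x ^ j) = v (x ^ q) := by
    obtain rfl | rfl : j = q ∨ l = q := by
      rw [Finset.mem_range] at hj hl
      by_contra! hne
      exact hjl (hmod.eq_of_lt_of_lt (by lia) (by lia))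
    · rw [htop]
    · rw [heq, htop]
  refine lt_of_not_ge fun hge ↦ ?_
  have heq' := (hval ▸ hmax i (by simp; lia)).antisymm hge
  have hmod' : i ≡ q [MOD q] := modEq_of_val_mul_pow_eq hπ hx hs (hcoeff hge)
    (hcoeff (by rw [htop])) (by rw [heq', htop])
  rw [Nat.ModEq, Nat.mod_self] at hmod'
  exact hi0 (Nat.eq_zero_of_dvd_of_lt (Nat.dvd_of_mod_eq_zero hmod') hiq)

variable (hq : q ≠ 0)
include hq

lemma sameLeadingTerm_coeff_zero_neg_pow :
    SameLeadingTerm v (algebraMap K F (g.coeff 0)) (-x ^ q) := by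
  have hx0 := ne_zero_of_val_pow_eq hπ hx hq
  have hlt : v (∑ i ∈ (Finset.range q).erase 0, algebraMap K F (g.coeff i) * x ^ i) < v (x ^ q) :=
    v.map_sum_lt (v.ne_zero_iff.2 (pow_ne_zero q hx0)) fun i hi ↦
      val_coeff_mul_pow_lt hπ hx hs hg hdeg hroot (Finset.ne_of_mem_erase hi)
        (Finset.mem_range.1 (Finset.mem_of_mem_erase hi))
  have hsum : aeval x g = algebraMap K F (g.coeff 0) +
      ∑ i ∈ (Finset.range q).erase 0, algebraMap K F (g.coeff i) * x ^ i + x ^ q := by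
    rw [aeval_eq_sum_range, hdeg, Finset.sum_range_succ, ← hdeg, hg.coeff_natDegree, one_smul, hdeg,
      ← Finset.add_sum_erase _ _ (Finset.mem_range.2 (Nat.pos_of_ne_zero hq))]
    simp [Algebra.smul_def]
  rw [SameLeadingTerm, Valuation.map_neg]
  convert hlt using 1
  rw [← Valuation.map_neg]
  congr 1
  linear_combination hsum - hroot

lemma sameLeadingTerm_aeval_derivative (hn : v q = 1) :
    SameLeadingTerm v (aeval x g.derivative) (q * x ^ (q - 1)) := by
  have hx0 := ne_zero_of_val_pow_eq hπ hx hq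
  have hpow : x ^ (q - 1) * x = x ^ q := pow_sub_one_mul hq x
  have hlt : v (∑ i ∈ Finset.range q, i * (algebraMap K F (g.coeff i) * x ^ i)) < v (x ^ q) := by
    refine v.map_sum_lt (v.ne_zero_iff.2 (pow_ne_zero q hx0)) fun i hi ↦ ?_
    obtain rfl | hi0 := eq_or_ne i 0
    · simpa [zero_lt_iff] using fun h ↦ absurd h hx0
    · rw [map_mul]
      exact (mul_le_of_le_one_left' (natCast_mem v.integer i)).trans_lt
        (val_coeff_mul_pow_lt hπ hx hs hg hdeg hroot hi0 (Finset.mem_range.1 hi))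
  have hsum : aeval x g.derivative * x =
      ∑ i ∈ Finset.range q, i * (algebraMap K F (g.coeff i) * x ^ i) + q * x ^ q := by
    have hterm (i : ℕ) : aeval x (C (g.coeff i * i) * X ^ (i - 1)) * x =
        i * (algebraMap K F (g.coeff i) * x ^ i) := by
      obtain rfl | hi := eq_or_ne i 0
      · simp
      · rw [map_mul, aeval_C, map_pow, aeval_X, mul_assoc, pow_sub_one_mul hi, map_mul,
          map_natCast]
        ring
    rw [derivative_apply, sum_over_range _ (by simp), hdeg, map_sum, Finset.sum_mul,
      Finset.sum_range_succ, hterm, ← hdeg, hg.coeff_natDegree, map_one, one_mul]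
    exact congrArg (· + _) (Finset.sum_congr rfl fun i _ ↦ hterm i)
  have hmul : SameLeadingTerm v (aeval x g.derivative * x) (q * x ^ (q - 1) * x) := by
    rwa [SameLeadingTerm, mul_assoc, hpow, hsum, add_sub_cancel_right, map_mul v (q : F), hn,
      one_mul]
  simpa [hx0] using hmul.div (.refl hx0)

end Valuation

lemma norm_eq_coeff_zero_minpoly [FiniteDimensional K F] {t : F} (ht : K⟮t⟯ = ⊤) :
    Algebra.norm K t = (-1) ^ Module.finrank K F * (minpoly K t).coeff 0 := by
  have hint : IsIntegral K t := Algebra.IsIntegral.isIntegral t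
  have h := Algebra.PowerBasis.norm_gen_eq_coeff_zero_minpoly
    ((adjoin.powerBasis hint).map ((equivOfEq ht).trans topEquiv))
  have hgen : ((adjoin.powerBasis hint).map ((equivOfEq ht).trans topEquiv)).gen = t := rfl
  rwa [hgen, PowerBasis.map_dim, adjoin.powerBasis_dim,
    (Field.primitive_element_iff_minpoly_natDegree_eq K t).1 ht] at h

lemma exists_neg_one_pow_eq_pow {q : ℕ} (hq : q.Prime) (R : Type*) [CommRing R] :
    ∃ δ : R, (-1) ^ (q * (q - 1) / 2) * (-1) ^ (q + 1) = δ ^ q := by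
  obtain rfl | hodd := hq.eq_two_or_odd'
  · exact ⟨1, by norm_num⟩
  · refine ⟨(-1) ^ (q * (q - 1) / 2), ?_⟩
    rw [hodd.add_one.neg_one_pow, mul_one, ← pow_mul, mul_comm _ q, pow_mul, hodd.neg_one_pow]

variable {k : Type*} [NontriviallyNormedField k] [CompleteSpace k] [IsUltrametricDist k]
  [Algebra k K] [Algebra k F] [IsScalarTower k K F]
  [Algebra.IsAlgebraic k K] [Algebra.IsAlgebraic k F]

lemma comap_spectralVal : (spectralVal k F).comap (algebraMap K F) = spectralVal k K := by
  ext x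
  rw [Valuation.comap_apply, spectralVal_algebraMap k x]

variable (hq : (Module.finrank K F).Prime) {π : K} (hπ : IsUniformizer (spectralVal k K) π)
  {x : F} {s : ℤ}
  (hx : spectralVal k F x ^ Module.finrank K F = spectralVal k K π ^ s)
  (hs : IsCoprime s (Module.finrank K F))
include hq hπ hx hs

lemma adjoin_eq_top_of_spectralVal_pow_eq : K⟮x⟯ = ⊤ := by
  rw [← comap_spectralVal (K := K) (F := F)] at hπ hx
  exact adjoin_eq_top_of_notMem_range hq (notMem_range_of_val_pow_eq hπ hx hs hq.one_lt)

variable [FiniteDimensional K F]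

lemma sameLeadingTerm_norm_pow :
    SameLeadingTerm (spectralVal k F) (algebraMap K F (Algebra.norm K x))
      ((-1) ^ (Module.finrank K F + 1) * x ^ Module.finrank K F) := by
  have htop := adjoin_eq_top_of_spectralVal_pow_eq hq hπ hx hs
  rw [norm_eq_coeff_zero_minpoly htop, pow_succ, mul_assoc, neg_one_mul, map_mul, map_pow, map_neg,
    map_one]
  refine .mul (.refl (by simp)) ?_
  rw [← comap_spectralVal (K := K) (F := F)] at hπ hx
  exact sameLeadingTerm_coeff_zero_neg_pow hπ hx hs
    (minpoly.monic (Algebra.IsIntegral.isIntegral x))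
    ((Field.primitive_element_iff_minpoly_natDegree_eq K x).1 htop) (minpoly.aeval K x)
    hq.ne_zero

variable [Algebra.IsSeparable K F] (hn : spectralVal k F (Module.finrank K F) = 1)
include hn

lemma sameLeadingTerm_discr_minpoly :
    SameLeadingTerm (spectralVal k F) (algebraMap K F (minpoly K x).discr)
      (algebraMap K F ((-1) ^ (Module.finrank K F * (Module.finrank K F - 1) / 2) *
        Algebra.norm K (Module.finrank K F * x ^ (Module.finrank K F - 1)))) := by
  have htop := adjoin_eq_top_of_spectralVal_pow_eq hq hπ hx hs
  rw [discr_minpoly_eq_norm htop, map_mul, map_mul]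
  rw [← comap_spectralVal (K := K) (F := F)] at hπ hx
  refine .mul (.refl (by simp)) (SameLeadingTerm.norm ?_)
  exact sameLeadingTerm_aeval_derivative hπ hx hs
    (minpoly.monic (Algebra.IsIntegral.isIntegral x))
    ((Field.primitive_element_iff_minpoly_natDegree_eq K x).1 htop) (minpoly.aeval K x)
    hq.ne_zero hn

lemma spectralVal_discr_minpoly_of_ramified :
    spectralVal k K (minpoly K x).discr = spectralVal k K π ^ (s * (Module.finrank K F - 1)) := by
  have h := (sameLeadingTerm_discr_minpoly hq hπ hx hs hn).val_eq
  rw [spectralVal_algebraMap k, map_mul (algebraMap K F), map_mul (spectralVal k F),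
    spectralVal_norm, map_mul (spectralVal k F) (_ : F) (x ^ _), hn, one_mul, map_pow _ x,
    pow_right_comm, hx] at h
  rw [h, ← Nat.cast_pred hq.pos, zpow_mul, zpow_natCast]
  simp

/-- As the norm `N` of `x` has the leading term of `± x ^ q`, the discriminant
`± q ^ q * N ^ (q - 1)` has the leading term of `± (q * N / x) ^ q`. -/
lemma exists_sameLeadingTerm_discr_minpoly_pow :
    ∃ y, SameLeadingTerm (spectralVal k F) (algebraMap K F (minpoly K x).discr)
      (y ^ Module.finrank K F) := by
  have hnorm := sameLeadingTerm_norm_pow hq hπ hx hs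
  have hdiscr := sameLeadingTerm_discr_minpoly hq hπ hx hs hn
  obtain ⟨δ, hδ⟩ := exists_neg_one_pow_eq_pow hq F
  set q := Module.finrank K F
  set N := algebraMap K F (Algebra.norm K x) with hN
  have hq0 : (q : F) ≠ 0 := by
    rintro h0
    simp [h0] at hn
  have hcast : Algebra.norm K (q : F) = q ^ q := by
    rw [← map_natCast (algebraMap K F), Algebra.norm_algebraMap]
  have heq : algebraMap K F ((-1) ^ (q * (q - 1) / 2) * Algebra.norm K (q * x ^ (q - 1))) =
      (-1) ^ (q * (q - 1) / 2) * (q * N) ^ q / N := by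
    rw [eq_div_iff hnorm.ne_zero_left, map_mul (Algebra.norm K), hcast, map_pow (Algebra.norm K),
      mul_pow, ← pow_sub_one_mul hq.ne_zero N, hN]
    simp only [map_mul, map_pow, map_neg, map_one, map_natCast]
    ring
  refine ⟨δ * (q * N) / x, hdiscr.trans ?_⟩
  rw [heq, div_pow, mul_pow δ, ← hδ]
  convert SameLeadingTerm.div (.refl (x := (-1) ^ (q * (q - 1) / 2) * (q * N) ^ q) ?_) hnorm using 1
  · rw [div_mul_eq_div_div, div_eq_mul_inv _ ((-1) ^ (q + 1)), ← inv_pow, inv_neg_one]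
    ring
  · simp [hq0, hnorm.ne_zero_left]

lemma nonempty_algEquiv_adjoin_of_ramified {u g d : K} {ℓ : ℤ}
    (hℓ : s * ℓ ≡ 1 [ZMOD Module.finrank K F])
    (hD : (minpoly K x).discr = π ^ (s * (Module.finrank K F - 1)) * u)
    (hd : SameLeadingTerm (spectralVal k K) (g * u ^ ℓ) (d ^ Module.finrank K F))
    (hg : spectralVal k K g = 1) {Ω : Type*} [Field Ω] [Algebra K Ω] {α : Ω}
    (hα : α ^ Module.finrank K F = algebraMap K Ω (g * π)) : Nonempty (F ≃ₐ[K] K⟮α⟯) := by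
  obtain ⟨y, hy⟩ := exists_sameLeadingTerm_discr_minpoly_pow hq hπ hx hs hn
  rw [← sameLeadingTerm_algebraMap_iff (k := k) (L := F)] at hd
  obtain ⟨z, hz⟩ := exists_mul_sameLeadingTerm_pow hℓ ((_root_.map_ne_zero _).2 hπ.ne_zero)
    (by simpa using congrArg (algebraMap K F) hD) hy (by simpa using hd)
  obtain ⟨w, hw, -⟩ := hz.exists_pow_eq hn
  have htop : K⟮w⟯ = ⊤ := by
    refine adjoin_eq_top_of_spectralVal_pow_eq (k := k) hq hπ (s := 1) ?_ isCoprime_one_left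
    rw [← map_pow, hw, map_mul, spectralVal_algebraMap k, spectralVal_algebraMap k, hg, one_mul,
      zpow_one]
  have hmin : minpoly K w = X ^ Module.finrank K F - C (g * π) := by
    have hroot : aeval w (X ^ Module.finrank K F - C (g * π)) = 0 := by simp [hw]
    refine (eq_of_monic_of_dvd_of_natDegree_le (minpoly.monic (Algebra.IsIntegral.isIntegral w))
      (monic_X_pow_sub_C _ hq.ne_zero) (minpoly.dvd K w hroot) ?_).symm
    rw [natDegree_X_pow_sub_C, (Field.primitive_element_iff_minpoly_natDegree_eq K w).1 htop]
  refine nonempty_algEquiv_adjoin_of_aeval_eq_zero htop (Algebra.IsIntegral.isIntegral w) ?_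
  rw [hmin]
  simp [hα]

end Ramified

section Unramified

variable {k K F : Type*} [NontriviallyNormedField k] [CompleteSpace k] [IsUltrametricDist k]
  [Field K] [Field F] [Algebra k K] [Algebra k F] [Algebra K F] [IsScalarTower k K F]
  [Algebra.IsAlgebraic k F] [FiniteDimensional K F] [Algebra.IsSeparable K F]

/-- The root of unity `η` is not in `K`, as a trace-zero element is not closer to an element of `K`
than to `0`. -/
lemma exists_rootOfUnity_sameLeadingTerm (hq : (Module.finrank K F).Prime)
    (hn : spectralVal k F (Module.finrank K F) = 1) {x : F} (hx : Algebra.trace K F x = 0) {N : ℕ}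
    (hN : spectralVal k F N = 1) {c : K}
    (hpow : SameLeadingTerm (spectralVal k F) ((x / algebraMap K F c) ^ N) 1) :
    ∃ η : F, η ^ N = 1 ∧ K⟮η⟯ = ⊤ ∧
      SameLeadingTerm (spectralVal k F) x (algebraMap K F c * η) := by
  have hc : algebraMap K F c ≠ 0 := by
    intro hc
    have hN0 : N ≠ 0 := by
      rintro rfl
      simp at hN
    exact hpow.ne_zero_left (by rw [hc, div_zero, zero_pow hN0])
  obtain ⟨η, hη, hηx⟩ := hpow.symm.exists_pow_eq hN
  have hx' : SameLeadingTerm (spectralVal k F) x (algebraMap K F c * η) := by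
    simpa [mul_div_cancel₀ _ hc] using (SameLeadingTerm.refl hc).mul hηx.symm
  refine ⟨η, hη, adjoin_eq_top_of_notMem_range hq ?_, hx'⟩
  rintro ⟨e, rfl⟩
  rw [← map_mul] at hx'
  exact (spectralVal_le_sub_of_trace_eq_zero hn hx (c * e)).not_gt (hx'.val_eq ▸ hx')

variable {η x : F} {n : ℕ} (hn : spectralVal k F n = 1) (hη : η ^ n = 1) (hgen : K⟮η⟯ = ⊤) {c : K}
  (hx : SameLeadingTerm (spectralVal k F) x (algebraMap K F c * η))
include hn hη hgen hx

omit [FiniteDimensional K F] in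
/-- Distinct roots of unity of order prime to the residue characteristic are not congruent. -/
lemma spectralVal_algHom_sub_algHom {Ω : Type*} [Field Ω] [Algebra k Ω] [Algebra.IsAlgebraic k Ω]
    [Algebra K Ω] [IsScalarTower k K Ω] {σ τ : F →ₐ[K] Ω} (h : σ ≠ τ) :
    spectralVal k Ω (σ x - τ x) = spectralVal k Ω (algebraMap K Ω c) := by
  have hn0 : n ≠ 0 := ne_zero_of_val_natCast_eq_one hn
  have hnΩ : spectralVal k Ω n = 1 := by rw [← map_natCast σ, spectralVal_algHom, hn]
  have hpow (ρ : F →ₐ[K] Ω) : ρ η ^ n = 1 := by rw [← map_pow, hη, map_one]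
  have hdiff : spectralVal k Ω (σ η - τ η) = 1 := by
    refine val_sub_eq_one_of_pow_eq_one hnΩ (hpow σ) (hpow τ) fun hστ ↦ h ?_
    have hadj : Algebra.adjoin K {η} = ⊤ := by
      rw [← adjoin_simple_toSubalgebra_of_isAlgebraic (Algebra.IsAlgebraic.isAlgebraic η), hgen,
        top_toSubalgebra]
    exact AlgHom.ext_of_adjoin_eq_top hadj (by simpa using hστ)
  have hconj (ρ : F →ₐ[K] Ω) :
      spectralVal k Ω (ρ x - algebraMap K Ω c * ρ η) < spectralVal k Ω (algebraMap K Ω c) := by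
    rw [← ρ.commutes, ← map_mul, ← map_sub, spectralVal_algHom, spectralVal_algHom]
    rwa [SameLeadingTerm, map_mul, val_eq_one_of_pow_eq_one hn0 hη, mul_one] at hx
  have hsub : SameLeadingTerm (spectralVal k Ω) (σ x - τ x)
      (algebraMap K Ω c * (σ η - τ η)) := by
    rw [SameLeadingTerm, map_mul, hdiff, mul_one]
    convert (spectralVal k Ω).map_sub_lt (hconj σ) (hconj τ) using 2
    ring
  rw [hsub.val_eq, map_mul, hdiff, mul_one]

lemma spectralVal_discr_minpoly_of_unramified (htop : K⟮x⟯ = ⊤) [Algebra.IsAlgebraic k K] :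
    spectralVal k K (minpoly K x).discr =
      spectralVal k K c ^ (Module.finrank K F * (Module.finrank K F - 1)) := by
  classical
  have : Algebra.IsAlgebraic k (AlgebraicClosure F) := .trans k F _
  have : IsScalarTower k K (AlgebraicClosure F) := .to₁₂₄ k K F _
  let σ := IsScalarTower.toAlgHom K F (AlgebraicClosure F)
  have hderiv : spectralVal k F (aeval x (minpoly K x).derivative) =
      spectralVal k K c ^ (Module.finrank K F - 1) := by
    rw [← spectralVal_algHom σ, algHom_aeval_derivative_minpoly htop, map_prod,
      Finset.prod_eq_pow_card fun τ hτ ↦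
        spectralVal_algHom_sub_algHom hn hη hgen hx (Finset.ne_of_mem_erase hτ).symm,
      Finset.card_erase_of_mem (Finset.mem_univ _), Finset.card_univ, AlgHom.card,
      IsScalarTower.algebraMap_apply K F, spectralVal_algebraMap k, spectralVal_algebraMap k]
  rw [discr_minpoly_eq_norm htop, map_mul, ← spectralVal_algebraMap k (L := F) (Algebra.norm K _),
    spectralVal_norm, hderiv, ← pow_mul, mul_comm (_ - 1)]
  simp

end Unramified

section Dichotomy

variable {k K F : Type*} [NontriviallyNormedField k] [CompleteSpace k] [IsUltrametricDist k]
  [Field K] [Field F] [Algebra k K] [Algebra k F] [Algebra K F] [IsScalarTower k K F]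
  [Algebra.IsAlgebraic k K] [Algebra.IsAlgebraic k F] [FiniteDimensional K F]

lemma exists_sameLeadingTerm_mul_pow (hq : (Module.finrank K F).Prime) {π : K}
    (hπ : IsUniformizer (spectralVal k K) π) {y : F} {s : ℤ}
    (hy : spectralVal k F y ^ Module.finrank K F = spectralVal k K π ^ s)
    (hs : IsCoprime s (Module.finrank K F)) {x : F} (hx : x ≠ 0) :
    ∃ b : K, ∃ i < Module.finrank K F,
      SameLeadingTerm (spectralVal k F) x (algebraMap K F b * y ^ i) := by
  have htop := adjoin_eq_top_of_spectralVal_pow_eq hq hπ hy hs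
  rw [← comap_spectralVal (K := K) (F := F)] at hπ hy
  have hint : IsIntegral K y := Algebra.IsIntegral.isIntegral y
  obtain ⟨g, hg, rfl⟩ : ∃ g : K[X], g.natDegree < Module.finrank K F ∧ aeval y g = x := by
    obtain ⟨g, hg, hgx⟩ := ((adjoin.powerBasis hint).map ((equivOfEq htop).trans
      topEquiv)).exists_eq_aeval x
    rw [PowerBasis.map_dim, adjoin.powerBasis_dim,
      (Field.primitive_element_iff_minpoly_natDegree_eq K y).1 htop] at hg
    exact ⟨g, hg, hgx.symm⟩
  rw [aeval_eq_sum_range' hg] at hx ⊢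
  simp only [Algebra.smul_def] at hx ⊢
  obtain ⟨i, hi, hmax⟩ := (Finset.range (Module.finrank K F)).exists_max_image
    (fun i ↦ spectralVal k F (algebraMap K F (g.coeff i) * y ^ i))
    ⟨0, Finset.mem_range.2 hq.pos⟩
  refine ⟨g.coeff i, i, Finset.mem_range.1 hi, ?_⟩
  have hi0 : algebraMap K F (g.coeff i) * y ^ i ≠ 0 := by
    intro h0
    refine hx (Finset.sum_eq_zero fun j hj ↦ (spectralVal k F).zero_iff.1 (le_zero_iff.1 ?_))
    simpa [h0] using hmax j hj
  rw [SameLeadingTerm, ← Finset.add_sum_erase _ _ hi, add_sub_cancel_left]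
  refine Valuation.map_sum_lt _ ((spectralVal k F).ne_zero_iff.2 hi0) fun j hj ↦ ?_
  obtain ⟨hji, hj⟩ := Finset.mem_erase.1 hj
  refine (hmax j hj).lt_of_ne fun heq ↦ hji ?_
  have hj0 : algebraMap K F (g.coeff j) * y ^ j ≠ 0 := by
    rwa [← (spectralVal k F).ne_zero_iff, heq, (spectralVal k F).ne_zero_iff]
  have hmod := modEq_of_val_mul_pow_eq hπ hy hs ((_root_.map_ne_zero _).1 (left_ne_zero_of_mul hj0))
    ((_root_.map_ne_zero _).1 (left_ne_zero_of_mul hi0)) heq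
  exact hmod.eq_of_lt_of_lt (Finset.mem_range.1 hj) (Finset.mem_range.1 hi)

variable [Algebra.IsSeparable K F]

lemma exists_spectralVal_pow_eq_zpow {π : K} (hπ : IsUniformizer (spectralVal k K) π) {y : F}
    (hy : y ≠ 0) : ∃ s : ℤ, spectralVal k F y ^ Module.finrank K F = spectralVal k K π ^ s := by
  obtain ⟨s, hs⟩ := hπ.exists_val_eq_zpow (Algebra.norm_ne_zero_iff.2 hy)
  exact ⟨s, by rw [← spectralVal_norm (K := K), spectralVal_algebraMap k, hs]⟩

variable (hq : (Module.finrank K F).Prime) {π : K} (hπ : IsUniformizer (spectralVal k K) π)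
include hq hπ

lemma exists_spectralVal_pow_eq_of_not_isUniformizer
    (hF : ¬ IsUniformizer (spectralVal k F) (algebraMap K F π)) :
    ∃ (y : F) (s : ℤ), spectralVal k F y ^ Module.finrank K F = spectralVal k K π ^ s ∧
      IsCoprime s (Module.finrank K F) := by
  obtain ⟨y, hy1, hyπ⟩ : ∃ y, spectralVal k F y < 1 ∧ spectralVal k K π < spectralVal k F y := by
    by_contra! h
    rw [← spectralVal_algebraMap k (L := F)] at h
    exact hF ⟨(_root_.map_ne_zero _).2 hπ.ne_zero,
      by rw [spectralVal_algebraMap k]; exact hπ.lt_one, h⟩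
  obtain ⟨s, hs⟩ := exists_spectralVal_pow_eq_zpow (F := F) hπ (y := y) (by
    rintro rfl
    simp at hyπ)
  have hs0 : 0 < s := by
    rw [← zpow_lt_one_iff_right_of_lt_one₀ hπ.val_pos hπ.lt_one, ← hs]
    exact pow_lt_one₀ zero_le hy1 hq.ne_zero
  have hsq : s < Module.finrank K F := by
    rw [← zpow_lt_zpow_iff_right_of_lt_one₀ hπ.val_pos hπ.lt_one, ← hs, zpow_natCast]
    exact pow_lt_pow_left₀ hyπ zero_le hq.ne_zero
  refine ⟨y, s, hs, ((Nat.prime_iff_prime_int.1 hq).coprime_iff_not_dvd.2 fun hdvd ↦ ?_).symm⟩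
  exact (Int.le_of_dvd hs0 hdvd).not_gt hsq

/-- If `F` is ramified over `K`, then so is any trace-zero generator: it has the leading term of
`b * y ^ i` for some `y` of fractional value, and `i ≠ 0` as it is not close to `K`. -/
lemma isUniformizer_or_spectralVal_pow_eq (hn : spectralVal k F (Module.finrank K F) = 1) {x : F}
    (hx : x ≠ 0) (htr : Algebra.trace K F x = 0) :
    IsUniformizer (spectralVal k F) (algebraMap K F π) ∨
      ∃ s : ℤ, spectralVal k F x ^ Module.finrank K F = spectralVal k K π ^ s ∧
        IsCoprime s (Module.finrank K F) := by
  refine or_iff_not_imp_left.2 fun hF ↦ ?_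
  obtain ⟨y, s, hy, hs⟩ := exists_spectralVal_pow_eq_of_not_isUniformizer hq hπ hF
  obtain ⟨b, i, hi, hxy⟩ := exists_sameLeadingTerm_mul_pow hq hπ hy hs hx
  have hb : b ≠ 0 := by
    rintro rfl
    exact hxy.ne_zero_right (by simp)
  have hi0 : i ≠ 0 := by
    rintro rfl
    rw [pow_zero, mul_one] at hxy
    exact (spectralVal_le_sub_of_trace_eq_zero hn htr b).not_gt (hxy.val_eq ▸ hxy)
  obtain ⟨n, hbn⟩ := hπ.exists_val_eq_zpow hb
  refine ⟨s * i + Module.finrank K F * n, ?_, (hs.mul_left ?_).add_mul_left_left n⟩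
  · rw [hxy.val_eq, map_mul, map_pow, spectralVal_algebraMap k, hbn, mul_pow, pow_right_comm, hy,
      zpow_add₀ hπ.val_pos.ne', zpow_mul, mul_comm _ n, zpow_mul, zpow_natCast, zpow_natCast,
      mul_comm]
  · exact Nat.isCoprime_iff_coprime.2 (Nat.coprime_of_lt_prime hi0 hi hq).symm

omit hq hπ [FiniteDimensional K F] [Algebra.IsSeparable K F] in
lemma dvd_of_isUniformizer_of_val_pow_eq {π : K}
    (hF : IsUniformizer (spectralVal k F) (algebraMap K F π)) {x : F} (hx : x ≠ 0) {q : ℕ} {s : ℤ}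
    (hxs : spectralVal k F x ^ q = spectralVal k K π ^ s) : (q : ℤ) ∣ s := by
  obtain ⟨n, hn⟩ := hF.exists_val_eq_zpow hx
  rw [← spectralVal_algebraMap k (L := F) π, hn, ← zpow_natCast, ← zpow_mul, hF.zpow_inj] at hxs
  exact ⟨n, by rw [← hxs, mul_comm]⟩

end Dichotomy

section ResidueField

open IsLocalRing

lemma isLocalRing_of_integers {O L : Type*} [CommRing O] [Field L] [Algebra O L]
    {v : Valuation L ℝ≥0} (hv : v.Integers O) : IsLocalRing O := by
  have : IsDomain O := hv.hom_inj.isDomain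
  have : ValuationRing O := .of_integers v hv
  infer_instance

variable {O L : Type*} [CommRing O] [IsLocalRing O] [Field L] [Algebra O L] {v : Valuation L ℝ≥0}
  (hv : v.Integers O)
include hv

lemma residue_eq_zero_iff_val_lt_one {x : O} :
    residue O x = 0 ↔ v (algebraMap O L x) < 1 := by
  rw [residue_eq_zero_iff, mem_maximalIdeal, mem_nonunits_iff,
    hv.isUnit_iff_valuation_eq_one, (hv.map_le_one x).lt_iff_ne]

lemma residue_eq_residue_iff_sameLeadingTerm {x y : O} (hy : v (algebraMap O L y) = 1) :
    residue O x = residue O y ↔ SameLeadingTerm v (algebraMap O L x) (algebraMap O L y) := by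
  rw [← sub_eq_zero, ← map_sub, residue_eq_zero_iff_val_lt_one hv, SameLeadingTerm, hy, map_sub]

lemma isUniformizer_iff_maximalIdeal_eq_span {ϖ : O} :
    IsUniformizer v (algebraMap O L ϖ) ↔ ϖ ≠ 0 ∧ maximalIdeal O = Ideal.span {ϖ} := by
  have hmem (x : O) : x ∈ maximalIdeal O ↔ v (algebraMap O L x) < 1 := by
    rw [← residue_eq_zero_iff, residue_eq_zero_iff_val_lt_one hv]
  have hspan (x : O) : x ∈ Ideal.span {ϖ} ↔ v (algebraMap O L x) ≤ v (algebraMap O L ϖ) := by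
    rw [Ideal.mem_span_singleton, hv.dvd_iff_le]
  have hzero : algebraMap O L ϖ ≠ 0 ↔ ϖ ≠ 0 := by
    rw [Ne, map_eq_zero_iff _ hv.hom_inj]
  constructor
  · intro hϖ
    refine ⟨hzero.1 hϖ.ne_zero, Ideal.ext fun x ↦ ?_⟩
    rw [hmem, hspan]
    exact ⟨hϖ.le_of_lt_one _, fun h ↦ h.trans_lt hϖ.lt_one⟩
  · rintro ⟨hϖ, hmax⟩
    refine ⟨hzero.2 hϖ, (hmem ϖ).1 (hmax ▸ Ideal.mem_span_singleton_self ϖ), fun x hx ↦ ?_⟩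
    obtain ⟨y, rfl⟩ := hv.exists_of_le_one hx.le
    rwa [← hspan, ← hmax, hmem]

lemma formallyUnramified_iff_isUniformizer {A : Type*} [CommRing A] [IsLocalRing A] [Algebra A O]
    [IsLocalHom (algebraMap A O)] [Module.Finite A O] [PerfectField (ResidueField A)] {ϖ : A}
    (hmax : maximalIdeal A = Ideal.span {ϖ}) (hϖ : algebraMap A O ϖ ≠ 0) :
    Algebra.FormallyUnramified A O ↔ IsUniformizer v (algebraMap O L (algebraMap A O ϖ)) := by
  have hsep : Algebra.IsSeparable (ResidueField A) (ResidueField O) := inferInstance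
  rw [Algebra.FormallyUnramified.iff_map_maximalIdeal_eq, hmax, Ideal.map_span,
    Set.image_singleton, isUniformizer_iff_maximalIdeal_eq_span hv,
    and_iff_right hsep, and_iff_right hϖ, eq_comm]

variable [Finite (ResidueField O)]

lemma val_natCard_residueField_sub_one : v (Nat.card (ResidueField O) - 1 : ℕ) = 1 := by
  have hcard : v (Nat.card (ResidueField O)) < v 1 := by
    have := Fintype.ofFinite (ResidueField O)
    have h := (residue_eq_zero_iff_val_lt_one hv (x := (Nat.card (ResidueField O) : O))).1
      (by rw [map_natCast, Nat.card_eq_fintype_card, Nat.cast_card_eq_zero])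
    rwa [map_natCast, ← v.map_one] at h
  rw [Nat.cast_sub Nat.card_pos, Nat.cast_one, Valuation.map_sub_eq_of_lt_right _ hcard, v.map_one]

lemma sameLeadingTerm_pow_natCard_residueField_sub_one {y : L} (hy : v y = 1) :
    SameLeadingTerm v (y ^ (Nat.card (ResidueField O) - 1)) 1 := by
  obtain ⟨y, rfl⟩ := hv.exists_of_le_one hy.le
  rw [← map_pow, ← map_one (algebraMap O L), ← residue_eq_residue_iff_sameLeadingTerm hv (by simp),
    map_pow, map_one]
  have := Fintype.ofFinite (ResidueField O)
  rw [Nat.card_eq_fintype_card]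
  refine FiniteField.pow_card_sub_one_eq_one _ fun h ↦ ?_
  exact ((residue_eq_zero_iff_val_lt_one hv).1 h).ne hy

end ResidueField

section Teichmuller

open IsLocalRing

variable {k O L : Type*} [NontriviallyNormedField k] [CompleteSpace k] [IsUltrametricDist k]
  [Field L] [Algebra k L] [Algebra.IsAlgebraic k L] [CommRing O] [IsLocalRing O] [Algebra O L]
  [Finite (ResidueField O)] (hv : (spectralVal k L).Integers O)
include hv

lemma exists_pow_eq_one_sameLeadingTerm {y : L} (hy : spectralVal k L y = 1) :
    ∃ ξ : L, ξ ^ (Nat.card (ResidueField O) - 1) = 1 ∧ SameLeadingTerm (spectralVal k L) y ξ := by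
  have h := (sameLeadingTerm_pow_natCard_residueField_sub_one hv hy).symm
  obtain ⟨ξ, hξ, hξy⟩ := h.exists_pow_eq (val_natCard_residueField_sub_one hv)
  exact ⟨ξ, hξ, hξy.symm⟩

variable (O) in
lemma exists_isPrimitiveRoot_natCard_residueField_sub_one :
    ∃ ξ : L, IsPrimitiveRoot ξ (Nat.card (ResidueField O) - 1) := by
  obtain ⟨g, hg⟩ := IsCyclic.exists_ofOrder_eq_natCard (α := (ResidueField O)ˣ)
  rw [Nat.card_units] at hg
  obtain ⟨y, hy⟩ := residue_surjective (g : ResidueField O)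
  have hvy : spectralVal k L (algebraMap O L y) = 1 :=
    le_antisymm (hv.map_le_one y) (not_lt.1 fun h ↦
      g.ne_zero (hy ▸ (residue_eq_zero_iff_val_lt_one hv).2 h))
  obtain ⟨ξ, hξ, hyξ⟩ := exists_pow_eq_one_sameLeadingTerm hv hvy
  have hvξ : spectralVal k L ξ = 1 := hyξ.val_eq ▸ hvy
  obtain ⟨ξ, rfl⟩ := hv.exists_of_le_one hvξ.le
  rw [← residue_eq_residue_iff_sameLeadingTerm hv hvξ, hy] at hyξ
  refine ⟨_, hξ, fun l hl ↦ ?_⟩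
  rw [← map_pow, ← map_one (algebraMap O L), hv.hom_inj.eq_iff] at hl
  rw [← hg, orderOf_dvd_iff_pow_eq_one, Units.ext_iff, Units.val_pow_eq_pow_val, hyξ, ← map_pow,
    hl, map_one, Units.val_one]

lemma exists_sameLeadingTerm_zpow {ζ : L}
    (hζ : IsPrimitiveRoot ζ (Nat.card (ResidueField O) - 1)) {y : L}
    (hy : spectralVal k L y = 1) :
    ∃ j : ℤ, SameLeadingTerm (spectralVal k L) y (ζ ^ j) := by
  obtain ⟨ξ, hξ, hyξ⟩ := exists_pow_eq_one_sameLeadingTerm hv hy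
  have : NeZero (Nat.card (ResidueField O) - 1) := ⟨(Nat.sub_pos_of_lt Finite.one_lt_card).ne'⟩
  obtain ⟨j, -, rfl⟩ := hζ.eq_pow_of_pow_eq_one hξ
  exact ⟨j, by rwa [zpow_natCast]⟩

end Teichmuller

section PowerResidues

lemma modEq_gcd_iff_exists_dvd_sub {a b : ℤ} {q M : ℕ} :
    a ≡ b [ZMOD (Nat.gcd q M : ℕ)] ↔ ∃ j : ℤ, (M : ℤ) ∣ a - b - q * j := by
  rw [Int.modEq_comm, Int.modEq_iff_dvd]
  constructor
  · rintro ⟨c, hc⟩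
    refine ⟨Nat.gcdA q M * c, Nat.gcdB q M * c, ?_⟩
    rw [hc, Nat.gcd_eq_gcd_ab]
    ring
  · rintro ⟨j, c, hc⟩
    rw [sub_eq_iff_eq_add.1 hc]
    exact dvd_add ((Int.natCast_dvd_natCast.2 (Nat.gcd_dvd_right _ _)).mul_right _)
      ((Int.natCast_dvd_natCast.2 (Nat.gcd_dvd_left _ _)).mul_right _)

variable {L : Type*} [Field L] {v : Valuation L ℝ≥0} {ζ : L} {M : ℕ}
  (hM : v M = 1) (hζ : IsPrimitiveRoot ζ M)
include hM hζ

lemma sameLeadingTerm_zpow_iff_dvd_sub {i j : ℤ} :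
    SameLeadingTerm v (ζ ^ i) (ζ ^ j) ↔ (M : ℤ) ∣ i - j := by
  have hM0 : M ≠ 0 := ne_zero_of_val_natCast_eq_one hM
  have hζ0 : ζ ≠ 0 := hζ.ne_zero hM0
  have hpow (i : ℤ) : (ζ ^ i) ^ M = 1 := by
    rw [← zpow_natCast, zpow_comm, zpow_natCast, hζ.pow_eq_one, one_zpow]
  rw [← hζ.zpow_eq_one_iff_dvd, zpow_sub₀ hζ0, div_eq_one_iff_eq (zpow_ne_zero _ hζ0)]
  exact ⟨fun h ↦ h.eq_of_pow_eq_pow hM ((hpow i).trans (hpow j).symm),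
    fun h ↦ h ▸ .refl (zpow_ne_zero _ hζ0)⟩

lemma exists_sameLeadingTerm_pow_iff_modEq
    (hunit : ∀ y : L, v y = 1 → ∃ j : ℤ, SameLeadingTerm v y (ζ ^ j)) {q : ℕ} (hq : q ≠ 0) {y : L}
    (hy : v y = 1) :
    ∃ r₀ : ℤ, ∀ r : ℤ, (∃ c, SameLeadingTerm v (ζ ^ r * y) (c ^ q)) ↔
      r ≡ r₀ [ZMOD (Nat.gcd q M : ℕ)] := by
  have hM0 : M ≠ 0 := ne_zero_of_val_natCast_eq_one hM
  have hζ0 : ζ ≠ 0 := hζ.ne_zero hM0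
  obtain ⟨t, ht⟩ := hunit y hy
  have hmul (r : ℤ) : SameLeadingTerm v (ζ ^ r * y) (ζ ^ (r + t)) :=
    zpow_add₀ hζ0 r t ▸ (SameLeadingTerm.refl (zpow_ne_zero r hζ0)).mul ht
  refine ⟨-t, fun r ↦ ?_⟩
  rw [modEq_gcd_iff_exists_dvd_sub]
  constructor
  · rintro ⟨c, hc⟩
    have hvc : v c = 1 := by
      rw [← pow_eq_one_iff_of_nonneg zero_le hq, ← map_pow, ← hc.val_eq, map_mul, hy, mul_one,
        map_zpow₀, val_eq_one_of_pow_eq_one hM0 hζ.pow_eq_one, one_zpow]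
    obtain ⟨j, hj⟩ := hunit c hvc
    have h := (hmul r).symm.trans (hc.trans (hj.pow q))
    rw [← zpow_natCast, ← zpow_mul, sameLeadingTerm_zpow_iff_dvd_sub hM hζ] at h
    exact ⟨j, by rwa [sub_neg_eq_add, mul_comm (q : ℤ)]⟩
  · rintro ⟨j, hj⟩
    refine ⟨ζ ^ j, (hmul r).trans ?_⟩
    rw [← zpow_natCast, ← zpow_mul, sameLeadingTerm_zpow_iff_dvd_sub hM hζ]
    rwa [sub_neg_eq_add, mul_comm (q : ℤ)] at hj

end PowerResidues

section PadicIntegers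

open IsLocalRing

variable {p : ℕ} [Fact p.Prime] {E : Type*} [Field E] [Algebra ℚ_[p] E]

lemma spectralVal_natCast_eq_one_iff [Algebra.IsAlgebraic ℚ_[p] E] {n : ℕ} :
    spectralVal ℚ_[p] E n = 1 ↔ p.Coprime n := by
  rw [← map_natCast (algebraMap ℚ_[p] E), spectralVal_algebraMap_base, ← NNReal.coe_inj,
    coe_nnnorm, NNReal.coe_one, Padic.norm_natCast_eq_one_iff]

lemma natCast_prime_ne_zero : (p : E) ≠ 0 := by
  have : CharZero E := charZero_of_injective_algebraMap (algebraMap ℚ_[p] E).injective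
  exact Nat.cast_ne_zero.2 (NeZero.ne p)

variable [Algebra ℤ_[p] E] [IsScalarTower ℤ_[p] ℚ_[p] E]

lemma isIntegral_padicInt_iff_spectralVal_le_one [Algebra.IsAlgebraic ℚ_[p] E] {x : E} :
    IsIntegral ℤ_[p] x ↔ spectralVal ℚ_[p] E x ≤ 1 := by
  have hx : IsIntegral ℚ_[p] x := Algebra.IsIntegral.isIntegral x
  rw [← NNReal.coe_le_coe, coe_spectralVal, NNReal.coe_one, spectralNorm,
    spectralValue_le_one_iff (minpoly.monic hx)]
  constructor
  · intro h n
    rw [minpoly.isIntegrallyClosed_eq_field_fractions' ℚ_[p] h, coeff_map]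
    exact PadicInt.norm_le_one _
  · intro h
    have hlift : minpoly ℚ_[p] x ∈ lifts (algebraMap ℤ_[p] ℚ_[p]) := by
      rw [lifts_iff_coeff_lifts]
      exact fun n ↦ ⟨⟨_, h n⟩, rfl⟩
    obtain ⟨g, hg, -, hmonic⟩ := lifts_and_degree_eq_and_monic hlift (minpoly.monic hx)
    exact ⟨g, hmonic, by rw [← aeval_def, ← aeval_map_algebraMap ℚ_[p], hg, minpoly.aeval]⟩

variable (p E) in
lemma integers_spectralVal [Algebra.IsAlgebraic ℚ_[p] E] (B : Type*) [CommRing B] [Algebra B E]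
    [IsIntegralClosure B ℤ_[p] E] : (spectralVal ℚ_[p] E).Integers B where
  hom_inj := IsIntegralClosure.algebraMap_injective B ℤ_[p] E
  map_le_one y := isIntegral_padicInt_iff_spectralVal_le_one.1
    ((IsIntegralClosure.isIntegral_iff (A := B)).2 ⟨y, rfl⟩)
  exists_of_le_one {_} hx := (IsIntegralClosure.isIntegral_iff (A := B)).1
    (isIntegral_padicInt_iff_spectralVal_le_one.2 hx)

instance [Algebra.IsAlgebraic ℚ_[p] E] : IsLocalRing (ringOfIntegers p E) :=
  isLocalRing_of_integers (integers_spectralVal p E (ringOfIntegers p E))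

instance : Finite (ResidueField ℤ_[p]) := .of_equiv (ZMod p) PadicInt.residueField.symm.toEquiv

variable [FiniteDimensional ℚ_[p] E]

instance : Module.Finite ℤ_[p] (ringOfIntegers p E) :=
  IsIntegralClosure.finite ℤ_[p] ℚ_[p] E _

instance : FaithfulSMul ℤ_[p] E := .trans ℤ_[p] ℚ_[p] E

instance : Finite (ResidueField (ringOfIntegers p E)) :=
  ResidueField.finite_of_finite (R := ℤ_[p]) inferInstance

lemma formallyUnramified_iff_isUniformizer_natCast {A B : Type*} [CommRing A] [IsLocalRing A]
    [Finite (ResidueField A)] [CommRing B] [Algebra A B] [Module.Finite A B] [FaithfulSMul A B]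
    [Algebra B E] [IsIntegralClosure B ℤ_[p] E] (hmax : maximalIdeal A = Ideal.span {(p : A)}) :
    Algebra.FormallyUnramified A B ↔ IsUniformizer (spectralVal ℚ_[p] E) (p : E) := by
  have hv := integers_spectralVal p E B
  have : IsLocalRing B := isLocalRing_of_integers hv
  have hp : algebraMap A B p ≠ 0 := by
    rw [← (IsIntegralClosure.algebraMap_injective B ℤ_[p] E).ne_iff, map_natCast, map_natCast,
      map_zero]
    exact natCast_prime_ne_zero
  rw [formallyUnramified_iff_isUniformizer hv hmax hp, map_natCast, map_natCast]

theorem isUnramifiedExt_padicInt_iff :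
    IsUnramifiedExt ℤ_[p] E ↔ IsUniformizer (spectralVal ℚ_[p] E) (p : E) :=
  formallyUnramified_iff_isUniformizer_natCast PadicInt.maximalIdeal_eq_span_p

lemma maximalIdeal_ringOfIntegers_eq_span_natCast
    (hp : IsUniformizer (spectralVal ℚ_[p] E) (p : E)) :
    maximalIdeal (ringOfIntegers p E) = Ideal.span {(p : ringOfIntegers p E)} :=
  ((isUniformizer_iff_maximalIdeal_eq_span (integers_spectralVal p E _)).1
    (by rwa [map_natCast])).2

theorem isUnramifiedExt_ringOfIntegers_iff {F : Type*} [Field F] [Algebra ℚ_[p] F]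
    [Algebra ℤ_[p] F] [IsScalarTower ℤ_[p] ℚ_[p] F] [FiniteDimensional ℚ_[p] F] [Algebra E F]
    [IsScalarTower ℤ_[p] E F] (hp : IsUniformizer (spectralVal ℚ_[p] E) (p : E)) :
    IsUnramifiedExt (ringOfIntegers p E) F ↔ IsUniformizer (spectralVal ℚ_[p] F) (p : F) := by
  let B := integralClosure (ringOfIntegers p E) F
  have : IsIntegralClosure B ℤ_[p] F :=
    { algebraMap_injective := Subtype.val_injective
      isIntegral_iff := fun {x} ↦ by
        refine ⟨fun h ↦ ⟨⟨x, h.tower_top⟩, rfl⟩, ?_⟩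
        rintro ⟨y, rfl⟩
        exact isIntegral_trans (A := ringOfIntegers p E) _ y.2 }
  have : Module.Finite ℤ_[p] B := IsIntegralClosure.finite ℤ_[p] ℚ_[p] F B
  have : Module.Finite (ringOfIntegers p E) B := .of_restrictScalars_finite ℤ_[p] _ _
  have : FaithfulSMul (ringOfIntegers p E) B :=
    (faithfulSMul_iff_algebraMap_injective _ _).2 fun x y h ↦
      Subtype.ext ((algebraMap E F).injective (congrArg (algebraMap B F) h))
  exact formallyUnramified_iff_isUniformizer_natCast
    (maximalIdeal_ringOfIntegers_eq_span_natCast hp)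

attribute [local instance] Ideal.Quotient.field in
lemma natCard_quotient_map_maximalIdeal (R S : Type*) [CommRing R] [IsLocalRing R] [CommRing S]
    [Algebra R S] [Module.Finite R S] [Module.Free R S] :
    Nat.card (S ⧸ (maximalIdeal R).map (algebraMap R S)) =
      Nat.card (ResidueField R) ^ Module.finrank R S := by
  have : Module.Finite (R ⧸ maximalIdeal R) (S ⧸ (maximalIdeal R).map (algebraMap R S)) :=
    .of_restrictScalars_finite R _ _
  rw [Module.natCard_eq_pow_finrank (K := R ⧸ maximalIdeal R), finrank_quotient_map]
  rfl

lemma natCard_residueField_ringOfIntegers (hp : IsUniformizer (spectralVal ℚ_[p] E) (p : E)) :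
    Nat.card (ResidueField (ringOfIntegers p E)) = p ^ Module.finrank ℚ_[p] E := by
  have : Module.IsTorsionFree ℤ_[p] E := .trans_faithfulSMul ℤ_[p] ℚ_[p] E
  have : Module.Free ℤ_[p] (ringOfIntegers p E) := IsIntegralClosure.module_free ℤ_[p] ℚ_[p] E _
  have hmax : (maximalIdeal ℤ_[p]).map (algebraMap ℤ_[p] (ringOfIntegers p E)) =
      maximalIdeal (ringOfIntegers p E) := by
    rw [maximalIdeal_ringOfIntegers_eq_span_natCast hp, PadicInt.maximalIdeal_eq_span_p,
      Ideal.map_span, Set.image_singleton, map_natCast]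
  have hcard := natCard_quotient_map_maximalIdeal ℤ_[p] (ringOfIntegers p E)
  rwa [hmax, IsIntegralClosure.rank ℤ_[p] ℚ_[p] E, Nat.card_congr PadicInt.residueField.toEquiv,
    Nat.card_zmod] at hcard

end PadicIntegers

section NormalizedValuation

variable {p : ℕ} [Fact p.Prime] {E : Type*} [Field E] [Algebra ℚ_[p] E]
  [Algebra.IsAlgebraic ℚ_[p] E]

lemma spectralVal_natCast_prime_pos : 0 < spectralVal ℚ_[p] E p :=
  zero_lt_iff.2 ((spectralVal ℚ_[p] E).ne_zero_iff.2 natCast_prime_ne_zero)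

lemma spectralVal_natCast_prime_lt_one : spectralVal ℚ_[p] E p < 1 := by
  rw [← map_natCast (algebraMap ℚ_[p] E), spectralVal_algebraMap_base, ← NNReal.coe_lt_coe]
  exact Padic.norm_p_lt_one

variable [Algebra ℤ_[p] E] [IsScalarTower ℤ_[p] ℚ_[p] E]

lemma exists_ringOfIntegers_eq_mul_iff {x y : E} (hy : y ≠ 0) :
    (∃ a : ringOfIntegers p E, x = y * a) ↔ spectralVal ℚ_[p] E x ≤ spectralVal ℚ_[p] E y := by
  have hvy : 0 < spectralVal ℚ_[p] E y := zero_lt_iff.2 ((spectralVal ℚ_[p] E).ne_zero_iff.2 hy)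
  rw [← div_le_one₀ hvy, ← map_div₀, ← isIntegral_padicInt_iff_spectralVal_le_one]
  constructor
  · rintro ⟨a, rfl⟩
    rw [mul_div_cancel_left₀ _ hy]
    exact a.2
  · intro h
    exact ⟨⟨x / y, h⟩, (mul_div_cancel₀ x hy).symm⟩

lemma val_eq_of_spectralVal_eq_zpow {x : E} {n : ℤ}
    (hx : spectralVal ℚ_[p] E x = spectralVal ℚ_[p] E p ^ n) : val p x = n := by
  have hset : {k : ℤ | ∃ a : ringOfIntegers p E, x = (p : E) ^ k * a} = Set.Iic n := by
    ext k
    rw [Set.mem_ofPred_eq, exists_ringOfIntegers_eq_mul_iff (zpow_ne_zero k natCast_prime_ne_zero),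
      hx, map_zpow₀, zpow_le_zpow_iff_right_of_lt_one₀ spectralVal_natCast_prime_pos
        spectralVal_natCast_prime_lt_one, Set.mem_Iic]
  rw [val, hset, csSup_Iic]

lemma isPowModP_iff_exists_sameLeadingTerm (hp : IsUniformizer (spectralVal ℚ_[p] E) (p : E))
    {n : ℕ} (hn : n ≠ 0) {x : E} (hx : spectralVal ℚ_[p] E x = 1) :
    IsPowModP p n x ↔ ∃ c : E, SameLeadingTerm (spectralVal ℚ_[p] E) x (c ^ n) := by
  have hmul (c : E) : (∃ a : ringOfIntegers p E, x = c ^ n + p * a) ↔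
      SameLeadingTerm (spectralVal ℚ_[p] E) (c ^ n) x := by
    simp only [← sub_eq_iff_eq_add']
    rw [exists_ringOfIntegers_eq_mul_iff hp.ne_zero, SameLeadingTerm, hx, Valuation.map_sub_swap]
    exact ⟨fun h ↦ h.trans_lt hp.lt_one, hp.le_of_lt_one _⟩
  constructor
  · rintro ⟨c, a, h⟩
    exact ⟨c, ((hmul c).1 ⟨a, h⟩).symm⟩
  · rintro ⟨c, hc⟩
    have hvc : spectralVal ℚ_[p] E c = 1 := by
      rw [← pow_eq_one_iff_of_nonneg zero_le hn, ← map_pow, ← hc.val_eq, hx]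
    obtain ⟨a, ha⟩ := (hmul c).2 hc.symm
    exact ⟨⟨c, isIntegral_padicInt_iff_spectralVal_le_one.2 hvc.le⟩, a, ha⟩

end NormalizedValuation

section Uniqueness

lemma coprime_pow_sub_one {a n : ℕ} (ha : 0 < a) (hn : n ≠ 0) : a.Coprime (a ^ n - 1) :=
  ((Nat.coprime_self_sub_right (Nat.one_le_pow n a ha)).2
    (Nat.coprime_one_right _)).coprime_dvd_left (dvd_pow_self a hn)

lemma IsUniformizer.of_algebraMap {k K L : Type*} [NontriviallyNormedField k] [CompleteSpace k]
    [IsUltrametricDist k] [Field K] [Field L] [Algebra k K] [Algebra k L] [Algebra K L]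
    [IsScalarTower k K L] [Algebra.IsAlgebraic k K] [Algebra.IsAlgebraic k L] {π : K}
    (hπ : IsUniformizer (spectralVal k L) (algebraMap K L π)) :
    IsUniformizer (spectralVal k K) π where
  ne_zero := (_root_.map_ne_zero _).1 hπ.ne_zero
  lt_one := spectralVal_algebraMap (L := L) k π ▸ hπ.lt_one
  le_of_lt_one x hx := by
    rw [← spectralVal_algebraMap (L := L) k x] at hx ⊢
    rw [← spectralVal_algebraMap (L := L) k π]
    exact hπ.le_of_lt_one _ hx

variable {p : ℕ} [Fact p.Prime] {E : Type*} [Field E] [Algebra ℚ_[p] E]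
  [Algebra.IsAlgebraic ℚ_[p] E]

lemma spectralVal_natCast_pow_sub_one {n : ℕ} (hn : n ≠ 0) :
    spectralVal ℚ_[p] E (p ^ n - 1 : ℕ) = 1 :=
  spectralVal_natCast_eq_one_iff.2 (coprime_pow_sub_one (Fact.out : p.Prime).pos hn)

lemma spectralVal_eq_one_of_isPrimitiveRoot {n : ℕ} (hn : n ≠ 0) {ξ : E}
    (hξ : IsPrimitiveRoot ξ (p ^ n - 1)) : spectralVal ℚ_[p] E ξ = 1 :=
  val_eq_one_of_pow_eq_one
    (ne_zero_of_val_natCast_eq_one (spectralVal_natCast_pow_sub_one (E := E) hn)) hξ.pow_eq_one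

variable {E : Type*} [Field E] [Algebra ℚ_[p] E] [FiniteDimensional ℚ_[p] E] [Algebra ℤ_[p] E]
  [IsScalarTower ℤ_[p] ℚ_[p] E]

lemma le_finrank_of_isPrimitiveRoot (hp : IsUniformizer (spectralVal ℚ_[p] E) (p : E)) {n : ℕ}
    (hn : n ≠ 0) {ξ : E} (hξ : IsPrimitiveRoot ξ (p ^ n - 1)) : n ≤ Module.finrank ℚ_[p] E := by
  have hp1 : 1 < p := (Fact.out : p.Prime).one_lt
  have hpow := sameLeadingTerm_pow_natCard_residueField_sub_one
    (integers_spectralVal p E (ringOfIntegers p E)) (spectralVal_eq_one_of_isPrimitiveRoot hn hξ)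
  rw [natCard_residueField_ringOfIntegers hp] at hpow
  have hξ1 := hpow.eq_of_pow_eq_pow (spectralVal_natCast_pow_sub_one hn) (by
    rw [← pow_mul, mul_comm, pow_mul, hξ.pow_eq_one, one_pow, one_pow])
  have hle : p ^ n - 1 ≤ p ^ Module.finrank ℚ_[p] E - 1 :=
    Nat.le_of_dvd (Nat.sub_pos_of_lt (Nat.one_lt_pow Module.finrank_pos.ne' hp1))
      (hξ.dvd_of_pow_eq_one _ hξ1)
  rwa [Nat.sub_le_sub_iff_right (Nat.one_le_pow _ _ hp1.le), Nat.pow_le_pow_iff_right hp1] at hle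

lemma adjoin_eq_top_of_isPrimitiveRoot (hp : IsUniformizer (spectralVal ℚ_[p] E) (p : E)) {ξ : E}
    (hξ : IsPrimitiveRoot ξ (p ^ Module.finrank ℚ_[p] E - 1)) : ℚ_[p]⟮ξ⟯ = ⊤ := by
  have hgen : IsPrimitiveRoot (AdjoinSimple.gen ℚ_[p] ξ) (p ^ Module.finrank ℚ_[p] E - 1) :=
    .of_map_of_injective (f := algebraMap ℚ_[p]⟮ξ⟯ E) hξ (algebraMap ℚ_[p]⟮ξ⟯ E).injective
  have hp' : IsUniformizer (spectralVal ℚ_[p] ℚ_[p]⟮ξ⟯) (p : ℚ_[p]⟮ξ⟯) :=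
    .of_algebraMap (L := E) (by rwa [map_natCast])
  refine eq_of_le_of_finrank_le le_top ?_
  rw [IntermediateField.finrank_top']
  exact le_finrank_of_isPrimitiveRoot hp' Module.finrank_pos.ne' hgen

lemma exists_isPrimitiveRoot_of_isUniformizer
    (hp : IsUniformizer (spectralVal ℚ_[p] E) (p : E)) :
    ∃ ξ : E, IsPrimitiveRoot ξ (p ^ Module.finrank ℚ_[p] E - 1) := by
  rw [← natCard_residueField_ringOfIntegers hp]
  exact exists_isPrimitiveRoot_natCard_residueField_sub_one _ (integers_spectralVal p E _)

lemma fieldRange_eq_adjoin_of_isPrimitiveRoot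
    (hp : IsUniformizer (spectralVal ℚ_[p] E) (p : E)) {Ω : Type*} [Field Ω] [Algebra ℚ_[p] Ω]
    (σ : E →ₐ[ℚ_[p]] Ω) {ω : Ω} (hω : IsPrimitiveRoot ω (p ^ Module.finrank ℚ_[p] E - 1)) :
    σ.fieldRange = ℚ_[p]⟮ω⟯ := by
  obtain ⟨ξ, hξ⟩ := exists_isPrimitiveRoot_of_isUniformizer hp
  have : NeZero (p ^ Module.finrank ℚ_[p] E - 1) :=
    ⟨Nat.sub_ne_zero_of_lt (Nat.one_lt_pow Module.finrank_pos.ne' (Fact.out : p.Prime).one_lt)⟩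
  obtain ⟨j, -, rfl⟩ := (hξ.map_of_injective σ.injective).eq_pow_of_pow_eq_one hω.pow_eq_one
  rw [← map_pow] at hω ⊢
  have htop := adjoin_eq_top_of_isPrimitiveRoot hp (hω.of_map_of_injective σ.injective)
  rw [AlgHom.fieldRange_eq_map, ← htop, adjoin_map, Set.image_singleton]
  rfl

variable {K Ω : Type*} [Field K] [Field Ω] [Algebra ℚ_[p] K] [Algebra ℚ_[p] Ω] [Algebra K Ω]
  [IsScalarTower ℚ_[p] K Ω]

instance [Algebra ℤ_[p] K] [IsScalarTower ℤ_[p] ℚ_[p] K] [Algebra ℤ_[p] Ω]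
    [IsScalarTower ℤ_[p] K Ω] (L : IntermediateField K Ω) : IsScalarTower ℤ_[p] ℚ_[p] L :=
  .of_algebraMap_eq fun a ↦ by
    rw [IsScalarTower.algebraMap_apply ℤ_[p] K L, IsScalarTower.algebraMap_apply ℚ_[p] K L,
      IsScalarTower.algebraMap_apply ℤ_[p] ℚ_[p] K]

theorem intermediateField_eq_of_isUniformizer [Algebra ℤ_[p] K] [IsScalarTower ℤ_[p] ℚ_[p] K]
    [Algebra ℤ_[p] Ω] [IsScalarTower ℤ_[p] K Ω]
    {L₁ L₂ : IntermediateField K Ω} [FiniteDimensional ℚ_[p] L₁] [FiniteDimensional ℚ_[p] L₂]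
    (hfin : Module.finrank K L₁ = Module.finrank K L₂)
    (h₁ : IsUniformizer (spectralVal ℚ_[p] L₁) (p : L₁))
    (h₂ : IsUniformizer (spectralVal ℚ_[p] L₂) (p : L₂)) : L₁ = L₂ := by
  have hfin' : Module.finrank ℚ_[p] L₁ = Module.finrank ℚ_[p] L₂ := by
    rw [← Module.finrank_mul_finrank ℚ_[p] K L₁, hfin, Module.finrank_mul_finrank]
  obtain ⟨ξ, hξ⟩ := exists_isPrimitiveRoot_of_isUniformizer h₁
  have hω := hξ.map_of_injective (algebraMap L₁ Ω).injective
  have hrange : (L₁.val.restrictScalars ℚ_[p]).fieldRange =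
      (L₂.val.restrictScalars ℚ_[p]).fieldRange := by
    rw [fieldRange_eq_adjoin_of_isPrimitiveRoot h₁ _ hω,
      fieldRange_eq_adjoin_of_isPrimitiveRoot h₂ _ (hfin' ▸ hω)]
  ext x
  simpa [AlgHom.mem_fieldRange] using SetLike.ext_iff.1 hrange x

theorem intermediateField_eq_of_isUnramifiedExt [Algebra ℤ_[p] K] [IsScalarTower ℤ_[p] ℚ_[p] K]
    [FiniteDimensional ℚ_[p] K] [Algebra ℤ_[p] Ω] [IsScalarTower ℤ_[p] K Ω]
    (hp : IsUniformizer (spectralVal ℚ_[p] K) (p : K)) {L₁ L₂ : IntermediateField K Ω}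
    [FiniteDimensional K L₁] [FiniteDimensional K L₂]
    (hfin : Module.finrank K L₁ = Module.finrank K L₂)
    (h₁ : IsUnramifiedExt (ringOfIntegers p K) L₁) (h₂ : IsUnramifiedExt (ringOfIntegers p K) L₂) :
    L₁ = L₂ := by
  have : FiniteDimensional ℚ_[p] L₁ := .trans ℚ_[p] K _
  have : FiniteDimensional ℚ_[p] L₂ := .trans ℚ_[p] K _
  exact intermediateField_eq_of_isUniformizer hfin ((isUnramifiedExt_ringOfIntegers_iff hp).1 h₁)
    ((isUnramifiedExt_ringOfIntegers_iff hp).1 h₂)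

end Uniqueness

section PrimeDegree

lemma exists_trace_eq_zero_discr_minpoly_eq {K F : Type*} [Field K] [Field F] [Algebra K F]
    [FiniteDimensional K F] [Algebra.IsSeparable K F] (hq : (Module.finrank K F).Prime)
    (hn : (Module.finrank K F : K) ≠ 0) {t : F} (ht : t ∉ Set.range (algebraMap K F)) :
    ∃ x ∉ Set.range (algebraMap K F), Algebra.trace K F x = 0 ∧
      (minpoly K x).discr = (minpoly K t).discr := by
  obtain ⟨a, ha⟩ := exists_trace_sub_algebraMap_eq_zero K hn t
  exact ⟨t - algebraMap K F a, fun ⟨b, hb⟩ ↦ ht ⟨b + a, by rw [map_add, hb, sub_add_cancel]⟩, ha,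
    discr_minpoly_sub_algebraMap hq ht a⟩

variable {p : ℕ} [Fact p.Prime] {K F : Type*} [Field K] [Field F] [Algebra ℚ_[p] K]
  [Algebra ℚ_[p] F] [Algebra K F] [IsScalarTower ℚ_[p] K F]

section Valuations

variable [Algebra ℤ_[p] F] [IsScalarTower ℤ_[p] ℚ_[p] F] [FiniteDimensional ℚ_[p] F]
  [Algebra.IsAlgebraic ℚ_[p] K] [FiniteDimensional K F] [Algebra.IsSeparable K F]

lemma spectralVal_discr_minpoly_of_isUniformizer
    (hq : (Module.finrank K F).Prime) (hpq : p.Coprime (Module.finrank K F))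
    (hF : IsUniformizer (spectralVal ℚ_[p] F) (p : F)) {x : F}
    (hx : x ∉ Set.range (algebraMap K F)) (htr : Algebra.trace K F x = 0) :
    ∃ n : ℤ, spectralVal ℚ_[p] K (minpoly K x).discr =
      spectralVal ℚ_[p] K p ^ (n * (Module.finrank K F * (Module.finrank K F - 1))) := by
  have hx0 : x ≠ 0 := fun h ↦ hx ⟨0, by rw [map_zero, h]⟩
  have hn := spectralVal_natCast_eq_one_iff (E := F).2 hpq
  obtain ⟨n, hxn⟩ := hF.exists_val_eq_zpow hx0
  have hunit : spectralVal ℚ_[p] F (x / algebraMap K F ((p : K) ^ n)) = 1 := by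
    rw [map_div₀, map_zpow₀, map_natCast, map_zpow₀, hxn, div_self (zpow_ne_zero n hF.val_pos.ne')]
  have hv := integers_spectralVal p F (ringOfIntegers p F)
  have hN := val_natCard_residueField_sub_one hv
  obtain ⟨η, hη, hgen, hxη⟩ := exists_rootOfUnity_sameLeadingTerm hq hn htr hN
    (sameLeadingTerm_pow_natCard_residueField_sub_one hv hunit)
  refine ⟨n, ?_⟩
  rw [spectralVal_discr_minpoly_of_unramified hN hη hgen hxη
    (adjoin_eq_top_of_notMem_range hq hx), map_zpow₀, zpow_mul, ← Nat.cast_pred hq.pos]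
  norm_cast

end Valuations

variable [Algebra ℤ_[p] K]

lemma zpow_val_mul_unitPart (x : K) : (p : K) ^ val p x * unitPart p x = x := by
  rw [unitPart, ← mul_assoc, ← zpow_add₀ natCast_prime_ne_zero, add_neg_cancel, zpow_zero, one_mul]

variable [IsScalarTower ℤ_[p] ℚ_[p] K] [FiniteDimensional ℚ_[p] K]
  [Algebra ℤ_[p] F] [IsScalarTower ℤ_[p] ℚ_[p] F] [FiniteDimensional ℚ_[p] F]

lemma spectralVal_unitPart (hp : IsUniformizer (spectralVal ℚ_[p] K) (p : K)) {x : K}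
    (hx : x ≠ 0) : spectralVal ℚ_[p] K (unitPart p x) = 1 := by
  obtain ⟨n, hn⟩ := hp.exists_val_eq_zpow hx
  rw [unitPart, val_eq_of_spectralVal_eq_zpow hn, map_mul, map_zpow₀, hn,
    ← zpow_add₀ hp.val_pos.ne', neg_add_cancel, zpow_zero]

theorem exists_isPowModP_iff_modEq (hp : IsUniformizer (spectralVal ℚ_[p] K) (p : K)) {ζ : K}
    (hζ : IsPrimitiveRoot ζ (p ^ Module.finrank ℚ_[p] K - 1)) {n : ℕ} (hn : n ≠ 0) {y : K}
    (hy : spectralVal ℚ_[p] K y = 1) :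
    ∃ r₀ : ℤ, ∀ r : ℤ, IsPowModP p n (ζ ^ r * y) ↔
      r ≡ r₀ [ZMOD (Nat.gcd n (p ^ Module.finrank ℚ_[p] K - 1) : ℕ)] := by
  have hv := integers_spectralVal p K (ringOfIntegers p K)
  have hvζ := spectralVal_eq_one_of_isPrimitiveRoot Module.finrank_pos.ne' hζ
  rw [← natCard_residueField_ringOfIntegers hp] at hζ ⊢
  have hM := val_natCard_residueField_sub_one hv
  obtain ⟨r₀, hr₀⟩ := exists_sameLeadingTerm_pow_iff_modEq hM hζ
    (fun _ ↦ exists_sameLeadingTerm_zpow hv hζ) hn hy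
  refine ⟨r₀, fun r ↦ (isPowModP_iff_exists_sameLeadingTerm hp hn ?_).trans (hr₀ r)⟩
  rw [map_mul, map_zpow₀, hvζ, one_zpow, hy, one_mul]

variable (hp : IsUniformizer (spectralVal ℚ_[p] K) (p : K)) (hq : (Module.finrank K F).Prime)
  (hpq : p.Coprime (Module.finrank K F)) {t : F} (ht : t ∉ Set.range (algebraMap K F))
include hp hq hpq ht

theorem isUniformizer_or_exists_spectralVal_pow_eq :
    (IsUniformizer (spectralVal ℚ_[p] F) (p : F) ∧
      (Module.finrank K F * (Module.finrank K F - 1) : ℤ) ∣ val p (minpoly K t).discr) ∨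
    ∃ (x : F) (s : ℤ), (minpoly K x).discr = (minpoly K t).discr ∧
      spectralVal ℚ_[p] F x ^ Module.finrank K F = spectralVal ℚ_[p] K p ^ s ∧
      IsCoprime s (Module.finrank K F) ∧
      val p (minpoly K t).discr = s * (Module.finrank K F - 1) := by
  have : CharZero K := charZero_of_injective_algebraMap (algebraMap ℚ_[p] K).injective
  have : FiniteDimensional K F := .right ℚ_[p] K F
  have hn := spectralVal_natCast_eq_one_iff (E := F).2 hpq
  obtain ⟨x, hx, htr, hdiscr⟩ :=
    exists_trace_eq_zero_discr_minpoly_eq hq (Nat.cast_ne_zero.2 hq.ne_zero) ht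
  have hx0 : x ≠ 0 := fun h ↦ hx ⟨0, by rw [map_zero, h]⟩
  rcases isUniformizer_or_spectralVal_pow_eq hq hp hn hx0 htr with hF | ⟨s, hxs, hs⟩
  · rw [map_natCast] at hF
    obtain ⟨n, hD⟩ := spectralVal_discr_minpoly_of_isUniformizer hq hpq hF hx htr
    refine .inl ⟨hF, n, ?_⟩
    rw [← hdiscr, val_eq_of_spectralVal_eq_zpow hD, mul_comm]
  · refine .inr ⟨x, s, hdiscr, hxs, hs, ?_⟩
    rw [← hdiscr, val_eq_of_spectralVal_eq_zpow
      (spectralVal_discr_minpoly_of_ramified hq hp hxs hs hn)]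

theorem dvd_val_discr_iff_isUniformizer :
    (Module.finrank K F * (Module.finrank K F - 1) : ℤ) ∣ val p (minpoly K t).discr ↔
      IsUniformizer (spectralVal ℚ_[p] F) (p : F) := by
  obtain ⟨hF, hdvd⟩ | ⟨x, s, -, hxs, hs, hval⟩ :=
    isUniformizer_or_exists_spectralVal_pow_eq hp hq hpq ht
  · exact iff_of_true hdvd hF
  have hsq : ¬ (Module.finrank K F : ℤ) ∣ s :=
    (Nat.prime_iff_prime_int.1 hq).coprime_iff_not_dvd.1 hs.symm
  refine iff_of_false (fun h ↦ hsq ?_) fun hF ↦ hsq ?_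
  · rw [hval] at h
    exact Int.dvd_of_mul_dvd_mul_right (sub_ne_zero.2 (by exact_mod_cast hq.one_lt.ne')) h
  · refine dvd_of_isUniformizer_of_val_pow_eq (K := K) (by rwa [map_natCast]) ?_ hxs
    rintro rfl
    rw [map_zero, zero_pow hq.ne_zero] at hxs
    exact zpow_ne_zero s hp.val_pos.ne' hxs.symm

variable (hdvd : ¬ (Module.finrank K F * (Module.finrank K F - 1) : ℤ) ∣
  val p (minpoly K t).discr)
include hdvd

theorem sub_one_dvd_val_discr_and_isCoprime :
    (Module.finrank K F - 1 : ℤ) ∣ val p (minpoly K t).discr ∧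
      IsCoprime (val p (minpoly K t).discr / (Module.finrank K F - 1)) (Module.finrank K F) := by
  obtain ⟨x, s, -, -, hs, hval⟩ :=
    (isUniformizer_or_exists_spectralVal_pow_eq hp hq hpq ht).resolve_left fun h ↦ hdvd h.2
  have hq1 : (Module.finrank K F - 1 : ℤ) ≠ 0 := sub_ne_zero.2 (by exact_mod_cast hq.one_lt.ne')
  rw [hval, Int.mul_ediv_cancel _ hq1]
  exact ⟨dvd_mul_left _ _, hs⟩

theorem nonempty_algEquiv_adjoin_of_isPowModP {ℓ : ℤ}
    (hℓ : val p (minpoly K t).discr / (Module.finrank K F - 1) * ℓ ≡ 1 [ZMOD Module.finrank K F])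
    {g : K} (hg : spectralVal ℚ_[p] K g = 1)
    (hpow : IsPowModP p (Module.finrank K F) (g * unitPart p (minpoly K t).discr ^ ℓ))
    {Ω : Type*} [Field Ω] [Algebra K Ω] {α : Ω}
    (hα : α ^ Module.finrank K F = algebraMap K Ω (g * p)) : Nonempty (F ≃ₐ[K] K⟮α⟯) := by
  have : CharZero K := charZero_of_injective_algebraMap (algebraMap ℚ_[p] K).injective
  have : FiniteDimensional K F := .right ℚ_[p] K F
  have hn := spectralVal_natCast_eq_one_iff (E := F).2 hpq
  have hq1 : (Module.finrank K F - 1 : ℤ) ≠ 0 := sub_ne_zero.2 (by exact_mod_cast hq.one_lt.ne')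
  obtain ⟨x, s, hdiscr, hxs, hs, hval⟩ :=
    (isUniformizer_or_exists_spectralVal_pow_eq hp hq hpq ht).resolve_left fun h ↦ hdvd h.2
  rw [hval, Int.mul_ediv_cancel _ hq1] at hℓ
  have hD0 : (minpoly K t).discr ≠ 0 :=
    discr_minpoly_ne_zero (adjoin_eq_top_of_notMem_range hq ht)
  have hunit : spectralVal ℚ_[p] K (g * unitPart p (minpoly K t).discr ^ ℓ) = 1 := by
    rw [map_mul, map_zpow₀, hg, spectralVal_unitPart hp hD0, one_zpow, one_mul]
  obtain ⟨d, hd⟩ := (isPowModP_iff_exists_sameLeadingTerm hp hq.ne_zero hunit).1 hpow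
  exact nonempty_algEquiv_adjoin_of_ramified hq hp hxs hs hn hℓ
    (by rw [hdiscr, ← hval, zpow_val_mul_unitPart]) hd hg hα

end PrimeDegree

section SimpleExtension

variable {K Ω : Type*} [Field K] [Field Ω] [Algebra K Ω] {f : K[X]} (hf : Irreducible f) {θ : Ω}
  (hθ : aeval θ f = 0)
include hf hθ

lemma rootDiscr_eq_discr_minpoly_gen : rootDiscr f = (minpoly K (AdjoinSimple.gen K θ)).discr := by
  rw [rootDiscr, mul_comm, minpoly.eq_of_irreducible hf hθ, minpoly_gen]

lemma finrank_adjoin_eq_natDegree : Module.finrank K K⟮θ⟯ = f.natDegree := by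
  have hint : IsIntegral K θ := IsAlgebraic.isIntegral ⟨f, hf.ne_zero, hθ⟩
  rw [adjoin.finrank hint, ← minpoly.eq_of_irreducible hf hθ,
    natDegree_mul_C (inv_ne_zero (leadingCoeff_ne_zero.2 hf.ne_zero))]

omit hf hθ in
lemma gen_notMem_range_algebraMap (h : Module.finrank K K⟮θ⟯ ≠ 1) :
    AdjoinSimple.gen K θ ∉ Set.range (algebraMap K K⟮θ⟯) := by
  rintro ⟨a, ha⟩
  have hbot : K⟮θ⟯ = ⊥ := by
    rw [adjoin_simple_eq_bot_iff, mem_bot]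
    exact ⟨a, congrArg (algebraMap K⟮θ⟯ Ω) ha⟩
  exact h (hbot ▸ IntermediateField.finrank_bot)

end SimpleExtension

end PadicExt

open PadicExt in
theorem mainTheorem1_general {p q : ℕ} [Fact p.Prime] (hq : q.Prime) (hpq : p ≠ q)
    {K Ω : Type*} [Field K] [Field Ω] [Algebra ℚ_[p] K] [Algebra ℤ_[p] K]
    [IsScalarTower ℤ_[p] ℚ_[p] K] [FiniteDimensional ℚ_[p] K] [Algebra ℚ_[p] Ω] [Algebra ℤ_[p] Ω]
    [Algebra K Ω] [IsScalarTower ℚ_[p] K Ω] [IsScalarTower ℤ_[p] K Ω]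
    (hK : IsUnramifiedExt ℤ_[p] K) {ζ : K}
    (hζ : IsPrimitiveRoot ζ (p ^ Module.finrank ℚ_[p] K - 1)) {f : K[X]} (hf : Irreducible f)
    (hdeg : f.natDegree = q) {θ : Ω} (hθ : aeval θ f = 0) :
    ((q : ℤ) * ((q : ℤ) - 1) ∣ val p (rootDiscr f) ↔
      Module.finrank K K⟮θ⟯ = q ∧ IsUnramifiedExt (ringOfIntegers p K) K⟮θ⟯ ∧
      ∀ L : IntermediateField K Ω, Module.finrank K L = q →
        IsUnramifiedExt (ringOfIntegers p K) L → L = K⟮θ⟯) ∧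
    (¬ (q : ℤ) * ((q : ℤ) - 1) ∣ val p (rootDiscr f) →
      (q : ℤ) - 1 ∣ val p (rootDiscr f) ∧
      IsCoprime (val p (rootDiscr f) / ((q : ℤ) - 1)) (q : ℤ) ∧
      ∀ ℓ : ℤ, val p (rootDiscr f) / ((q : ℤ) - 1) * ℓ ≡ 1 [ZMOD q] →
        (∃ r₀ : ℤ, ∀ r : ℤ, IsPowModP p q (ζ ^ r * unitPart p (rootDiscr f) ^ ℓ) ↔
          r ≡ r₀ [ZMOD (Nat.gcd q (p ^ Module.finrank ℚ_[p] K - 1) : ℕ)]) ∧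
        ∀ r : ℤ, IsPowModP p q (ζ ^ r * unitPart p (rootDiscr f) ^ ℓ) →
          ∀ α : Ω, α ^ q = algebraMap K Ω (ζ ^ r * (p : K)) → Nonempty (K⟮θ⟯ ≃ₐ[K] K⟮α⟯)) := by
  have hp := isUnramifiedExt_padicInt_iff.1 hK
  obtain rfl := (finrank_adjoin_eq_natDegree hf hθ).trans hdeg
  have : FiniteDimensional K K⟮θ⟯ := Module.finite_of_finrank_pos hq.pos
  have : FiniteDimensional ℚ_[p] K⟮θ⟯ := .trans ℚ_[p] K _
  have hpq' := (Nat.coprime_primes Fact.out hq).2 hpq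
  have ht := gen_notMem_range_algebraMap hq.one_lt.ne'
  rw [rootDiscr_eq_discr_minpoly_gen hf hθ]
  refine ⟨?_, fun hdvd ↦ ?_⟩
  · rw [dvd_val_discr_iff_isUniformizer hp hq hpq' ht, ← isUnramifiedExt_ringOfIntegers_iff hp]
    refine ⟨fun h ↦ ⟨rfl, h, fun L hL hLu ↦ ?_⟩, fun h ↦ h.2.1⟩
    have : FiniteDimensional K L := Module.finite_of_finrank_pos (hL ▸ hq.pos)
    exact intermediateField_eq_of_isUnramifiedExt hp hL hLu h
  · have : CharZero K := charZero_of_injective_algebraMap (algebraMap ℚ_[p] K).injective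
    have hunit := spectralVal_unitPart hp
      (discr_minpoly_ne_zero (adjoin_eq_top_of_notMem_range hq ht))
    have hvζ := spectralVal_eq_one_of_isPrimitiveRoot Module.finrank_pos.ne' hζ
    obtain ⟨hdvd', hcop⟩ := sub_one_dvd_val_discr_and_isCoprime hp hq hpq' ht hdvd
    refine ⟨hdvd', hcop, fun ℓ hℓ ↦ ⟨?_, fun r hr α hα ↦ ?_⟩⟩
    · exact exists_isPowModP_iff_modEq hp hζ hq.ne_zero (by rw [map_zpow₀, hunit, one_zpow])
    · exact nonempty_algEquiv_adjoin_of_isPowModP hp hq hpq' ht hdvd hℓ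
        (by rw [map_zpow₀, hvζ, one_zpow]) hr hα

theorem mainTheorem1 (p q m : ℕ) [Fact p.Prime] (hq : q.Prime) (hpq : p ≠ q)
    (K : Type*) [Field K] [Algebra ℚ_[p] K] [Algebra ℤ_[p] K] [IsScalarTower ℤ_[p] ℚ_[p] K]
    [FiniteDimensional ℚ_[p] K] (hm : Module.finrank ℚ_[p] K = m)
    (hK : PadicExt.IsUnramifiedExt ℤ_[p] K)
    (ζ : K) (hζ : IsPrimitiveRoot ζ (p ^ m - 1))
    (f : (PadicExt.ringOfIntegers p K)[X])
    (hf : Irreducible (f.map (algebraMap (PadicExt.ringOfIntegers p K) K)))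
    (hdeg : f.natDegree = q)
    (θ : AlgebraicClosure K)
    (hθ : aeval θ (f.map (algebraMap (PadicExt.ringOfIntegers p K) K)) = 0)
    (Δ u : K) (hΔ : Δ = PadicExt.rootDiscr (f.map (algebraMap (PadicExt.ringOfIntegers p K) K)))
    (hu : u = PadicExt.unitPart p Δ) (v : ℤ) (hv : v = PadicExt.val p Δ) :
    ((q : ℤ) * ((q : ℤ) - 1) ∣ v ↔
      Module.finrank K K⟮θ⟯ = q ∧
      PadicExt.IsUnramifiedExt (PadicExt.ringOfIntegers p K) K⟮θ⟯ ∧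
      ∀ L : IntermediateField K (AlgebraicClosure K), Module.finrank K L = q →
        PadicExt.IsUnramifiedExt (PadicExt.ringOfIntegers p K) L → L = K⟮θ⟯) ∧
    (¬ (q : ℤ) * ((q : ℤ) - 1) ∣ v →
      (q : ℤ) - 1 ∣ v ∧ IsCoprime (v / ((q : ℤ) - 1)) (q : ℤ) ∧
      ∀ ℓ : ℤ, v / ((q : ℤ) - 1) * ℓ ≡ 1 [ZMOD q] →
        (∃ r₀ : ℤ, ∀ r : ℤ, PadicExt.IsPowModP p q (ζ ^ r * u ^ ℓ) ↔
          r ≡ r₀ [ZMOD (Nat.gcd q (p ^ m - 1) : ℕ)]) ∧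
        ∀ r : ℤ, PadicExt.IsPowModP p q (ζ ^ r * u ^ ℓ) →
          ∀ α : AlgebraicClosure K, α ^ q = algebraMap K (AlgebraicClosure K) (ζ ^ r * (p : K)) →
            Nonempty (K⟮θ⟯ ≃ₐ[K] K⟮α⟯)) := by
  subst hm hΔ hu hv
  exact mainTheorem1_general hq hpq hK hζ hf
    ((natDegree_map_eq_of_injective Subtype.val_injective f).trans hdeg) hθ
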